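/- Let $p\ge 1$ be real and $\beta\in\mathbb R$. A function $\phi:[0,\infty)\to\mathbb R$ is called a *$(p,\beta)$-function* if there exist a strictly increasing sequence $(\lambda_n)$ of positive real numbers tending to infinity, a sequence $(r_n)$ of complex numbers, and numbers $y_0,X_0>0$ such that $\phi\in L^p([0,y_0])$; for all $y\ge y_0$ and $X\ge X_0$ $$\phi(y)=\Re\Big(\sum_{0<\lambda_n\le X} r_n e^{i\lambda_n y}\Big)+\mathcal E(y,X);$$ there is a non-decreasing function $X(Y)$, with $X(Y)\ge X_0$ for all large $Y$, such that $\mathcal E(\cdot,X(Y))\in L^p([y_0,Y])$ for all large $Y$ and $$\lim_{Y\to\infty}\frac1Y\int_{y_0}^Y|\mathcal E(y,X(Y))|^p\,dy=0;$$ and, as $T\to\infty$, $$\sum_{T\le\lambda_n\le T+1}|r_n|=O(T^{-\beta}).$$ A *limiting distribution* of a (measurable) function $\phi$ is a Borel probability measure $\mu$ on $\mathbb R$ such that $\lim_{Y\to\infty}\frac1Y\int_0^Y g(\phi(y))\,dy=\int_{\mathbb R} g\,d\mu$ for every bounded continuous $g:\mathbb R\to\mathbb R$. **Corollary.** Let $p\ge2$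 be real, let $\beta>1-\frac1{2p+4}$, and let $\phi$ be a $(p,\beta)$-function. Then $\phi$ has a unique limiting distribution $\mu$, and for every integer $n$ with $1\le n\le p$ the function $\phi^n$ is integrable on $[0,Y]$ for every $Y\ge0$, the function $x^n$ is $\mu$-integrable, the asymptotic moment of order $n$ of $\phi$ exists, and $$\lim_{Y\to\infty}\frac1Y\int_0^Y\phi(y)^n\,dy=\int_{\mathbb R}x^n\,d\mu(x).$$ -/

import Mathlib

open MeasureTheory Filter Topology Asymptotics
open scoped BoundedContinuousFunction

/-- The trigonometric sum `∑_{0 < λ_n ≤ X} r_n e^{i λ_n y}`. The index set is finite whenever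
`λ_n → ∞`, which is the only case in which this is used. -/
noncomputable def trigSum (lam : ℕ → ℝ) (r : ℕ → ℂ) (y X : ℝ) : ℂ :=
  ∑ᶠ n ∈ {n : ℕ | 0 < lam n ∧ lam n ≤ X}, r n * Complex.exp (Complex.I * (lam n : ℂ) * (y : ℂ))

/-- The sum `∑_{T ≤ λ_n ≤ T + 1} |r_n|` (finite whenever `λ_n → ∞`). -/
noncomputable def coeffMass (lam : ℕ → ℝ) (r : ℕ → ℂ) (T : ℝ) : ℝ :=
  ∑ᶠ n ∈ {n : ℕ | T ≤ lam n ∧ lam n ≤ T + 1}, ‖r n‖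

/-- `φ` (only its values on `[0, ∞)` matter) is a `p`-function, with frequencies `lam` and
coefficients `r`. In the last clause `φ` is compared with its trigonometric sums of length `X Y`;
the remainder `E · (X Y)` is asked to be in `L^p([y₀, Y])` for all large `Y`, so that its
`p`-th mean is a genuine integral, and `X Y` must lie in the range `[X₀, ∞)` where the remainder
is tied to `φ`. -/
structure IsPFunctionWith (φ : ℝ → ℝ) (p : ℝ) (lam : ℕ → ℝ) (r : ℕ → ℂ) : Prop where
  one_le : 1 ≤ p
  strictMono : StrictMono lam
  pos : ∀ n, 0 < lam n
  tendsto_atTop : Tendsto lam atTop atTop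
  expansion : ∃ y₀ X₀ : ℝ, 0 < y₀ ∧ 0 < X₀ ∧
    MemLp φ (ENNReal.ofReal p) (volume.restrict (Set.Icc 0 y₀)) ∧
    ∃ E : ℝ → ℝ → ℝ,
      (∀ y X : ℝ, y₀ ≤ y → X₀ ≤ X → φ y = (trigSum lam r y X).re + E y X) ∧
      ∃ X : ℝ → ℝ, MonotoneOn X (Set.Ici y₀) ∧ (∀ᶠ Y in atTop, X₀ ≤ X Y) ∧
        (∀ᶠ Y in atTop, MemLp (fun y => E y (X Y)) (ENNReal.ofReal p)
          (volume.restrict (Set.Icc y₀ Y))) ∧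
        Tendsto (fun Y : ℝ => Y⁻¹ * ∫ y in y₀..Y, |E y (X Y)| ^ p) atTop (𝓝 0)

/-- `φ` is a `p`-function. -/
def IsPFunction (φ : ℝ → ℝ) (p : ℝ) : Prop :=
  ∃ (lam : ℕ → ℝ) (r : ℕ → ℂ), IsPFunctionWith φ p lam r

/-- `φ` is a `(p, β)`-function: a `p`-function whose coefficients satisfy
`∑_{T ≤ λ_n ≤ T + 1} |r_n| ≪ T^{-β}` for `T ≫ 1`. -/
def IsPBetaFunction (φ : ℝ → ℝ) (p β : ℝ) : Prop :=
  ∃ (lam : ℕ → ℝ) (r : ℕ → ℂ), IsPFunctionWith φ p lam r ∧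
    (fun T : ℝ => coeffMass lam r T) =O[atTop] (fun T : ℝ => 1 / T ^ β)

/-- The probability measure `μ` on `ℝ` is a limiting distribution of `φ : [0, ∞) → ℝ`. -/
structure IsLimitingDistribution (φ : ℝ → ℝ) (μ : Measure ℝ) : Prop where
  isProbabilityMeasure : IsProbabilityMeasure μ
  aemeasurable : AEMeasurable φ (volume.restrict (Set.Ici 0))
  tendsto : ∀ g : ℝ →ᵇ ℝ,
    Tendsto (fun Y : ℝ => Y⁻¹ * ∫ y in (0 : ℝ)..Y, g (φ y)) atTop (𝓝 (∫ x, g x ∂μ))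

/-!
A `(p, β)`-function is almost periodic in the sense of Besicovitch: up to an arbitrarily small error
in the `p`-th mean over `[0, Y]`, uniformly for large `Y`, it is the real part of a finite
exponential sum (`IsPFunctionWith.isMeanApproximable`). Everything else is a consequence of this.

The point is to bound the `p`-th mean of the part of the exponential sum with frequencies between
`N` and `X(Y)`, uniformly in `Y`, whatever the growth of `X`. Let `S` be the sum over a block of
frequencies in `[M, 4M)`. The mass hypothesis gives `|S| ≪ M ^ (1 - β)`. In the mean square of `S`,
pairs of frequencies within `√M` of each other are bounded trivially, and every other pair has mean
`O(1 / √M)`, so the mean square is `≪ M ^ (3 / 2 - 2 β)`. Hence the mean of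
`|S| ^ p ≤ (sup |S|) ^ (p - 2) |S| ^ 2` is `≪ M ^ ((1 - β) p - 1 / 2)`. The hypothesis on `β` makes
this exponent negative, so the `L ^ p` norms of the blocks `M = 4 ^ j` decay geometrically
and can be summed by Minkowski's inequality (`exists_forall_eLpNorm_expSum_le`).

If `P` is a trigonometric polynomial, then `e ^ {itP}` is a uniform limit of trigonometric
polynomials and has a mean value. By approximation so has `e ^ {itφ}`. As the laws of `φ` on
`[0, Y]` are tight, the theorems of Prokhorov and Lévy give their convergence in law
(`IsMeanApproximable.exists_tendsto_law`).

For the moments of order `n ≤ p`, uniform integrability of `φ ^ n` is needed, also for `n = p`. If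
`|P| ≤ K` and `|φ| > 2 K`, then `|φ| ≤ 2 |φ - P|`, so the large values of `φ` contribute to the mean
of `|φ| ^ p` at most `2 ^ p` times the mean of `|φ - P| ^ p`, which is as small as desired
(`IsMeanApproximable.exists_eventually_lintegral_truncationError_le`).
-/

/-! ### Finite exponential sums -/

/-- The finite exponential sum `∑_{n ∈ F} r_n e^{i λ_n y}`. -/
noncomputable def expSum (lam : ℕ → ℝ) (r : ℕ → ℂ) (F : Finset ℕ) (y : ℝ) : ℂ :=
  ∑ n ∈ F, r n * Complex.exp (Complex.I * (lam n : ℂ) * (y : ℂ))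

lemma continuous_expSum (lam : ℕ → ℝ) (r : ℕ → ℂ) (F : Finset ℕ) :
    Continuous (expSum lam r F) := by
  unfold expSum
  fun_prop

lemma norm_exp_I_mul_ofReal_mul_ofReal (a y : ℝ) :
    ‖Complex.exp (Complex.I * (a : ℂ) * (y : ℂ))‖ = 1 := by
  have h : Complex.I * (a : ℂ) * (y : ℂ) = ((a * y : ℝ) : ℂ) * Complex.I := by
    push_cast; ring
  rw [h, Complex.norm_exp_ofReal_mul_I]

lemma norm_expSum_le (lam : ℕ → ℝ) (r : ℕ → ℂ) (F : Finset ℕ) (y : ℝ) :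
    ‖expSum lam r F y‖ ≤ ∑ n ∈ F, ‖r n‖ := by
  refine (norm_sum_le _ _).trans (Finset.sum_le_sum fun n _ => ?_)
  rw [norm_mul, norm_exp_I_mul_ofReal_mul_ofReal, mul_one]

lemma norm_integral_exp_le (a : ℝ) {Y : ℝ} (hY : 0 ≤ Y) :
    ‖∫ y in (0 : ℝ)..Y, Complex.exp (Complex.I * (a : ℂ) * (y : ℂ))‖ ≤ Y := by
  have h := intervalIntegral.norm_integral_le_of_norm_le_const (a := 0) (b := Y) (C := 1)
    (f := fun y : ℝ => Complex.exp (Complex.I * (a : ℂ) * (y : ℂ)))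
    (fun y _ => (norm_exp_I_mul_ofReal_mul_ofReal a y).le)
  simpa [abs_of_nonneg hY] using h

lemma norm_integral_exp_le_two_div {a : ℝ} (ha : a ≠ 0) (Y : ℝ) :
    ‖∫ y in (0 : ℝ)..Y, Complex.exp (Complex.I * (a : ℂ) * (y : ℂ))‖ ≤ 2 / |a| := by
  have hc : Complex.I * (a : ℂ) ≠ 0 := mul_ne_zero Complex.I_ne_zero (by exact_mod_cast ha)
  rw [integral_exp_mul_complex hc, norm_div]
  have hn : ‖Complex.I * (a : ℂ)‖ = |a| := by simp
  rw [hn]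
  gcongr
  refine (norm_sub_le _ _).trans ?_
  rw [norm_exp_I_mul_ofReal_mul_ofReal, norm_exp_I_mul_ofReal_mul_ofReal]
  norm_num

lemma integral_sq_norm_expSum_le (lam : ℕ → ℝ) (r : ℕ → ℂ) (F : Finset ℕ) {Y : ℝ} (hY : 0 ≤ Y) :
    ∫ y in (0 : ℝ)..Y, ‖expSum lam r F y‖ ^ 2 ≤ ∑ m ∈ F, ∑ n ∈ F, ‖r m‖ * ‖r n‖ *
      ‖∫ y in (0 : ℝ)..Y, Complex.exp (Complex.I * ((lam m - lam n : ℝ) : ℂ) * (y : ℂ))‖ := by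
  have hexp : ∀ y : ℝ, ((‖expSum lam r F y‖ ^ 2 : ℝ) : ℂ) = ∑ m ∈ F, ∑ n ∈ F,
      (r m * (starRingEnd ℂ) (r n)) *
        Complex.exp (Complex.I * ((lam m - lam n : ℝ) : ℂ) * (y : ℂ)) := by
    intro y
    have h1 : ((‖expSum lam r F y‖ ^ 2 : ℝ) : ℂ)
        = expSum lam r F y * (starRingEnd ℂ) (expSum lam r F y) := by
      rw [Complex.mul_conj, Complex.normSq_eq_norm_sq]
    rw [h1]
    unfold expSum
    rw [map_sum, Finset.sum_mul_sum]
    refine Finset.sum_congr rfl fun m _ => Finset.sum_congr rfl fun n _ => ?_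
    rw [map_mul, ← Complex.exp_conj]
    simp only [map_mul, Complex.conj_I, Complex.conj_ofReal]
    have : Complex.I * ((lam m - lam n : ℝ) : ℂ) * (y : ℂ)
        = Complex.I * (lam m : ℂ) * (y : ℂ) + -Complex.I * (lam n : ℂ) * (y : ℂ) := by
      push_cast; ring
    rw [this, Complex.exp_add]
    ring
  have hint : ((∫ y in (0 : ℝ)..Y, ‖expSum lam r F y‖ ^ 2 : ℝ) : ℂ) = ∑ m ∈ F, ∑ n ∈ F,
      (r m * (starRingEnd ℂ) (r n)) *
        ∫ y in (0 : ℝ)..Y, Complex.exp (Complex.I * ((lam m - lam n : ℝ) : ℂ) * (y : ℂ)) := by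
    rw [← intervalIntegral.integral_ofReal]
    simp_rw [hexp]
    rw [intervalIntegral.integral_finsetSum]
    · refine Finset.sum_congr rfl fun m _ => ?_
      rw [intervalIntegral.integral_finsetSum]
      · refine Finset.sum_congr rfl fun n _ => ?_
        rw [intervalIntegral.integral_const_mul]
      · intro n _
        exact Continuous.intervalIntegrable (by fun_prop) _ _
    · intro m _
      exact Continuous.intervalIntegrable (by fun_prop) _ _
  have hnn : 0 ≤ ∫ y in (0 : ℝ)..Y, ‖expSum lam r F y‖ ^ 2 :=
    intervalIntegral.integral_nonneg hY fun y _ => by positivity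
  calc ∫ y in (0 : ℝ)..Y, ‖expSum lam r F y‖ ^ 2
      = ‖((∫ y in (0 : ℝ)..Y, ‖expSum lam r F y‖ ^ 2 : ℝ) : ℂ)‖ := by
        rw [Complex.norm_real, Real.norm_of_nonneg hnn]
    _ ≤ _ := by
        rw [hint]
        refine (norm_sum_le _ _).trans (Finset.sum_le_sum fun m _ => ?_)
        refine (norm_sum_le _ _).trans (Finset.sum_le_sum fun n _ => ?_)
        rw [norm_mul, norm_mul, RCLike.norm_conj]

/-! ### Blocks of frequencies -/

/-- If every unit interval to the right of `M` carries coefficient mass at most `B`, an interval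
of length `k` to the right of `M` carries mass at most `k B`. -/
lemma sum_norm_filter_le {lam : ℕ → ℝ} {r : ℕ → ℂ} {M B : ℝ} {F : Finset ℕ}
    (hB : ∀ T, M ≤ T → ∑ n ∈ F with T ≤ lam n ∧ lam n ≤ T + 1, ‖r n‖ ≤ B) (k : ℕ) {a : ℝ}
    (ha : M ≤ a) :
    ∑ n ∈ F with a ≤ lam n ∧ lam n ≤ a + (k + 1 : ℕ), ‖r n‖ ≤ (k + 1 : ℕ) * B := by
  induction k with
  | zero => simpa using hB a ha
  | succ k ih =>
    have hsub : F.filter (fun n => a ≤ lam n ∧ lam n ≤ a + (k + 1 + 1 : ℕ)) ⊆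
        F.filter (fun n => a ≤ lam n ∧ lam n ≤ a + (k + 1 : ℕ)) ∪
        F.filter (fun n => a + (k + 1 : ℕ) ≤ lam n ∧ lam n ≤ a + (k + 1 : ℕ) + 1) := by
      intro n hn
      simp only [Finset.mem_union, Finset.mem_filter] at hn ⊢
      push_cast at hn ⊢
      rcases le_total (lam n) (a + (k + 1)) with h | h
      · exact Or.inl ⟨hn.1, hn.2.1, h⟩
      · exact Or.inr ⟨hn.1, h, by linarith [hn.2.2]⟩
    have hunion := Finset.sum_union_inter (f := fun n => ‖r n‖)
      (s₁ := F.filter (fun n => a ≤ lam n ∧ lam n ≤ a + (k + 1 : ℕ)))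
      (s₂ := F.filter (fun n => a + (k + 1 : ℕ) ≤ lam n ∧ lam n ≤ a + (k + 1 : ℕ) + 1))
    have hinter : 0 ≤ ∑ n ∈ F.filter (fun n => a ≤ lam n ∧ lam n ≤ a + (k + 1 : ℕ)) ∩
        F.filter (fun n => a + (k + 1 : ℕ) ≤ lam n ∧ lam n ≤ a + (k + 1 : ℕ) + 1), ‖r n‖ :=
      Finset.sum_nonneg fun _ _ => norm_nonneg _
    have hle := Finset.sum_le_sum_of_subset_of_nonneg (f := fun n => ‖r n‖) hsub
      fun _ _ _ => norm_nonneg _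
    have hlast := hB (a + (k + 1 : ℕ)) (by
      have : (0 : ℝ) ≤ (k + 1 : ℕ) := by positivity
      linarith)
    have hcast : ((k + 1 + 1 : ℕ) : ℝ) * B = (k + 1 : ℕ) * B + B := by push_cast; ring
    linarith

lemma sum_norm_le_of_block {lam : ℕ → ℝ} {r : ℕ → ℂ} {M B : ℝ} {F : Finset ℕ}
    (hB : ∀ T, M ≤ T → ∑ n ∈ F with T ≤ lam n ∧ lam n ≤ T + 1, ‖r n‖ ≤ B) {k : ℕ} (hk : 1 ≤ k)
    (hF : ∀ n ∈ F, M ≤ lam n ∧ lam n ≤ M + k) :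
    ∑ n ∈ F, ‖r n‖ ≤ k * B := by
  obtain ⟨k, rfl⟩ : ∃ l, k = l + 1 := ⟨k - 1, by omega⟩
  have h := sum_norm_filter_le hB k le_rfl
  rwa [Finset.filter_true_of_mem hF] at h

/-- The mean square of a block is estimated by its diagonal and near-diagonal terms
(frequencies within `D`), bounded trivially, and by the remaining terms, whose mean over
`[0, Y]` is at most `2 / D`. -/
lemma mean_sq_norm_expSum_le_of_block {lam : ℕ → ℝ} {r : ℕ → ℂ} {M B : ℝ} {F : Finset ℕ}
    (hB : ∀ T, M ≤ T → ∑ n ∈ F with T ≤ lam n ∧ lam n ≤ T + 1, ‖r n‖ ≤ B) {k : ℕ} (hk : 1 ≤ k)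
    (hF : ∀ n ∈ F, M ≤ lam n ∧ lam n ≤ M + k) {D : ℕ} (hD : 1 ≤ D) {Y : ℝ} (hY : 1 ≤ Y) :
    Y⁻¹ * ∫ y in (0 : ℝ)..Y, ‖expSum lam r F y‖ ^ 2 ≤
      (k * B) * (2 * D * B + 2 / D * (k * B)) := by
  have hY0 : 0 < Y := by linarith
  have hD0 : (0 : ℝ) < D := by exact_mod_cast hD
  have hkB := sum_norm_le_of_block hB hk hF
  have hkB0 : 0 ≤ k * B := (Finset.sum_nonneg fun _ _ => norm_nonneg _).trans hkB
  have hpair : ∀ a : ℝ,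
      Y⁻¹ * ‖∫ y in (0 : ℝ)..Y, Complex.exp (Complex.I * (a : ℂ) * (y : ℂ))‖ ≤
        (if |a| ≤ D then 1 else 0) + 2 / D := by
    intro a
    split_ifs with h
    · have := norm_integral_exp_le a hY0.le
      have h1 : Y⁻¹ * ‖∫ y in (0 : ℝ)..Y, Complex.exp (Complex.I * (a : ℂ) * (y : ℂ))‖ ≤ 1 := by
        rw [inv_mul_le_iff₀ hY0]; linarith
      have : 0 ≤ 2 / (D : ℝ) := by positivity
      linarith
    · push Not at h
      have ha : a ≠ 0 := by
        rintro rfl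
        simp at h
        linarith
      have h1 := norm_integral_exp_le_two_div ha Y
      have h2 : 2 / |a| ≤ 2 / D := by gcongr
      have h3 : Y⁻¹ ≤ 1 := inv_le_one_of_one_le₀ hY
      calc _ ≤ 1 * (2 / (D : ℝ)) := by
            gcongr
            exact h1.trans h2
        _ = _ := by ring
  have hrow : ∀ m ∈ F, ∑ n ∈ F, ‖r n‖ * ((if |lam m - lam n| ≤ D then 1 else 0) + 2 / D) ≤
      2 * D * B + 2 / D * (k * B) := by
    intro m hm
    simp_rw [mul_add]
    rw [Finset.sum_add_distrib]
    refine add_le_add ?_ ?_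
    · simp only [mul_ite, mul_one, mul_zero]
      rw [← Finset.sum_filter]
      have h := sum_norm_filter_le hB (2 * D - 1) (le_max_left M (lam m - D))
      have h2D : 2 * D - 1 + 1 = 2 * D := by omega
      rw [h2D] at h
      push_cast at h
      refine le_trans (Finset.sum_le_sum_of_subset_of_nonneg ?_ fun _ _ _ => norm_nonneg _) h
      intro n hn
      simp only [Finset.mem_filter] at hn ⊢
      obtain ⟨hn1, hn2⟩ := hn
      rw [abs_le] at hn2
      refine ⟨hn1, max_le (hF n hn1).1 (by linarith), ?_⟩
      have := le_max_right M (lam m - D)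
      linarith
    · rw [← Finset.sum_mul, mul_comm]
      gcongr
  calc Y⁻¹ * ∫ y in (0 : ℝ)..Y, ‖expSum lam r F y‖ ^ 2
      ≤ Y⁻¹ * ∑ m ∈ F, ∑ n ∈ F, ‖r m‖ * ‖r n‖ *
        ‖∫ y in (0 : ℝ)..Y, Complex.exp (Complex.I * ((lam m - lam n : ℝ) : ℂ) * (y : ℂ))‖ := by
        gcongr
        exact integral_sq_norm_expSum_le lam r F hY0.le
    _ = ∑ m ∈ F, ‖r m‖ * ∑ n ∈ F, ‖r n‖ * (Y⁻¹ *
        ‖∫ y in (0 : ℝ)..Y, Complex.exp (Complex.I * ((lam m - lam n : ℝ) : ℂ) * (y : ℂ))‖) := by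
        simp_rw [Finset.mul_sum]
        refine Finset.sum_congr rfl fun m _ => Finset.sum_congr rfl fun n _ => ?_
        ring
    _ ≤ ∑ m ∈ F, ‖r m‖ * (2 * D * B + 2 / D * (k * B)) := by
        refine Finset.sum_le_sum fun m hm => ?_
        refine mul_le_mul_of_nonneg_left (le_trans ?_ (hrow m hm)) (norm_nonneg _)
        exact Finset.sum_le_sum fun n _ =>
          mul_le_mul_of_nonneg_left (hpair _) (norm_nonneg _)
    _ ≤ _ := by
        rw [← Finset.sum_mul]
        refine mul_le_mul_of_nonneg_right hkB ?_
        by_cases hne : F.Nonempty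
        · obtain ⟨m, hm⟩ := hne
          refine le_trans (Finset.sum_nonneg fun n _ => ?_) (hrow m hm)
          have : 0 ≤ 2 / (D : ℝ) := by positivity
          refine mul_nonneg (norm_nonneg _) (add_nonneg ?_ this)
          split_ifs <;> norm_num
        · rw [Finset.not_nonempty_iff_eq_empty] at hne
          have hB0 : 0 ≤ B := by
            have := hB M le_rfl
            simpa [hne] using this
          positivity

/-- Interpolation between the supremum and the mean square: the `p`-th mean of a block. -/
lemma mean_rpow_norm_expSum_le_of_block {lam : ℕ → ℝ} {r : ℕ → ℂ} {M B : ℝ} {F : Finset ℕ}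
    (hB : ∀ T, M ≤ T → ∑ n ∈ F with T ≤ lam n ∧ lam n ≤ T + 1, ‖r n‖ ≤ B) {k : ℕ} (hk : 1 ≤ k)
    (hF : ∀ n ∈ F, M ≤ lam n ∧ lam n ≤ M + k) {D : ℕ} (hD : 1 ≤ D) {Y : ℝ} (hY : 1 ≤ Y)
    {p : ℝ} (hp : 2 ≤ p) :
    Y⁻¹ * ∫ y in (0 : ℝ)..Y, ‖expSum lam r F y‖ ^ p ≤
      (k * B) ^ (p - 2) * ((k * B) * (2 * D * B + 2 / D * (k * B))) := by
  have hY0 : 0 < Y := by linarith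
  have hkB := sum_norm_le_of_block hB hk hF
  have hkB0 : 0 ≤ k * B := (Finset.sum_nonneg fun _ _ => norm_nonneg _).trans hkB
  have hc := continuous_expSum lam r F
  have hpt : ∀ y, ‖expSum lam r F y‖ ^ p ≤ (k * B) ^ (p - 2) * ‖expSum lam r F y‖ ^ 2 := by
    intro y
    have h1 : ‖expSum lam r F y‖ ^ p
        = ‖expSum lam r F y‖ ^ (p - 2) * ‖expSum lam r F y‖ ^ 2 := by
      rw [← Real.rpow_two, ← Real.rpow_add_of_nonneg (norm_nonneg _) (by linarith) (by norm_num)]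
      congr 1; ring
    rw [h1]
    have h2 : ‖expSum lam r F y‖ ≤ k * B := (norm_expSum_le lam r F y).trans hkB
    have h3 : 0 ≤ p - 2 := by linarith
    gcongr
  calc Y⁻¹ * ∫ y in (0 : ℝ)..Y, ‖expSum lam r F y‖ ^ p
      ≤ Y⁻¹ * ∫ y in (0 : ℝ)..Y, (k * B) ^ (p - 2) * ‖expSum lam r F y‖ ^ 2 := by
        gcongr
        refine intervalIntegral.integral_mono_on hY0.le ?_ ?_ fun y _ => hpt y
        · exact Continuous.intervalIntegrable
            (hc.norm.rpow_const fun _ => Or.inr (by linarith)) _ _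
        · exact Continuous.intervalIntegrable (by fun_prop) _ _
    _ = (k * B) ^ (p - 2) * (Y⁻¹ * ∫ y in (0 : ℝ)..Y, ‖expSum lam r F y‖ ^ 2) := by
        rw [intervalIntegral.integral_const_mul]; ring
    _ ≤ _ := by
        refine mul_le_mul_of_nonneg_left ?_ (Real.rpow_nonneg hkB0 _)
        exact mean_sq_norm_expSum_le_of_block hB hk hF hD hY

/-! ### Means over `[0, Y]` -/

/-- The normalized Lebesgue measure on `(0, Y]`, so that integrals against it are means over
`[0, Y]`. It is the zero measure for `Y ≤ 0`. -/
noncomputable def uniformMeasure (Y : ℝ) : Measure ℝ :=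
  ENNReal.ofReal Y⁻¹ • volume.restrict (Set.Ioc 0 Y)

lemma isProbabilityMeasure_uniformMeasure {Y : ℝ} (hY : 0 < Y) :
    IsProbabilityMeasure (uniformMeasure Y) := by
  constructor
  simp only [uniformMeasure, Measure.smul_apply, Measure.restrict_apply_univ, Real.volume_Ioc,
    sub_zero, smul_eq_mul]
  rw [← ENNReal.ofReal_mul (by positivity), inv_mul_cancel₀ hY.ne', ENNReal.ofReal_one]

lemma integral_uniformMeasure {E : Type*} [NormedAddCommGroup E] [NormedSpace ℝ E] {Y : ℝ}
    (hY : 0 < Y) (f : ℝ → E) :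
    ∫ y, f y ∂(uniformMeasure Y) = Y⁻¹ • ∫ y in (0 : ℝ)..Y, f y := by
  rw [uniformMeasure, integral_smul_measure, intervalIntegral.integral_of_le hY.le,
    ENNReal.toReal_ofReal (by positivity)]

lemma Continuous.memLp_uniformMeasure {E : Type*} [NormedAddCommGroup E] {f : ℝ → E}
    (hf : Continuous f) (p : ENNReal) (Y : ℝ) : MemLp f p (uniformMeasure Y) := by
  refine MemLp.smul_measure ?_ ENNReal.ofReal_ne_top
  have h : IsCompact (f '' Set.Icc 0 Y) := isCompact_Icc.image hf
  obtain ⟨C, hC⟩ := h.isBounded.exists_norm_le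
  refine MemLp.of_bound hf.aestronglyMeasurable C ?_
  refine (ae_restrict_iff' measurableSet_Ioc).2 (Eventually.of_forall fun y hy => ?_)
  exact hC _ ⟨y, Set.Ioc_subset_Icc_self hy, rfl⟩

/-! ### The tail of the exponential sum is small in the mean -/

/-- The bound for the block `[4 ^ j, 4 ^ (j + 1)]`. Powers of `4` are used so that the cut-off `D`
between near and far pairs of frequencies is the natural number `2 ^ j = √(4 ^ j)`. -/
lemma eLpNorm_expSum_le_of_block {lam : ℕ → ℝ} {r : ℕ → ℂ} {T₀ C β p : ℝ} (hp : 2 ≤ p)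
    (hβ : 0 ≤ β) (hC : 0 ≤ C)
    (hmass : ∀ (F : Finset ℕ) (T : ℝ), T₀ ≤ T →
      ∑ n ∈ F with T ≤ lam n ∧ lam n ≤ T + 1, ‖r n‖ ≤ C * T ^ (-β))
    {j : ℕ} (hj : T₀ ≤ 4 ^ j) {F : Finset ℕ} (hF : ∀ n ∈ F, 4 ^ j ≤ lam n ∧ lam n ≤ 4 ^ (j + 1))
    {Y : ℝ} (hY : 1 ≤ Y) :
    eLpNorm (expSum lam r F) (ENNReal.ofReal p) (uniformMeasure Y) ≤
      ENNReal.ofReal (((3 * C) ^ (p - 2) * (24 * C ^ 2)) ^ p⁻¹ *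
        ((4 : ℝ) ^ (((1 - β) * p - 1 / 2) / p)) ^ j) := by
  have hp0 : 0 < p := by linarith
  have hY0 : 0 < Y := by linarith
  set x : ℝ := 4 ^ j with hx
  have hx0 : 0 < x := by positivity
  have hB : ∀ T, x ≤ T → ∑ n ∈ F with T ≤ lam n ∧ lam n ≤ T + 1, ‖r n‖ ≤ C * x ^ (-β) := by
    intro T hT
    refine (hmass F T (hj.trans hT)).trans ?_
    refine mul_le_mul_of_nonneg_left ?_ hC
    exact Real.rpow_le_rpow_of_nonpos hx0 hT (by linarith)
  have hF' : ∀ n ∈ F, x ≤ lam n ∧ lam n ≤ x + (3 * 4 ^ j : ℕ) := by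
    intro n hn
    refine ⟨(hF n hn).1, (hF n hn).2.trans (le_of_eq ?_)⟩
    push_cast
    rw [pow_succ]; ring
  have hk1 : 1 ≤ 3 * 4 ^ j := by have := Nat.one_le_pow j 4 (by norm_num); omega
  have hmain := mean_rpow_norm_expSum_le_of_block hB hk1 hF'
    (Nat.one_le_pow j 2 (by norm_num)) hY hp
  have hD : ((2 ^ j : ℕ) : ℝ) = x ^ (1 / 2 : ℝ) := by
    have h4 : (4 : ℝ) = 2 ^ (2 : ℕ) := by norm_num
    rw [hx, h4, ← pow_mul, mul_comm, pow_mul, ← Real.sqrt_eq_rpow, Real.sqrt_sq (by positivity)]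
    push_cast; rfl
  have hk : ((3 * 4 ^ j : ℕ) : ℝ) = 3 * x := by push_cast; rfl
  rw [hD, hk] at hmain
  have hkB : 3 * x * (C * x ^ (-β)) = 3 * C * x ^ (1 - β) := by
    rw [sub_eq_add_neg, Real.rpow_add hx0, Real.rpow_one]; ring
  have hright : 2 * x ^ (1 / 2 : ℝ) * (C * x ^ (-β)) + 2 / x ^ (1 / 2 : ℝ) *
      (3 * x * (C * x ^ (-β))) = 8 * C * x ^ (1 / 2 - β) := by
    have h1 : x / x ^ (1 / 2 : ℝ) = x ^ (1 / 2 : ℝ) := by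
      rw [div_eq_iff (by positivity), ← Real.rpow_add hx0]; norm_num
    have h2 : x ^ (1 / 2 - β) = x ^ (1 / 2 : ℝ) * x ^ (-β) := by
      rw [sub_eq_add_neg, Real.rpow_add hx0]
    rw [h2]
    calc _ = 2 * x ^ (1 / 2 : ℝ) * (C * x ^ (-β)) +
          6 * (x / x ^ (1 / 2 : ℝ)) * (C * x ^ (-β)) := by ring
      _ = _ := by rw [h1]; ring
  rw [hright, hkB, Real.mul_rpow (by positivity) (by positivity), ← Real.rpow_mul hx0.le] at hmain
  have hbound : (3 * C) ^ (p - 2) * x ^ ((1 - β) * (p - 2)) *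
      (3 * C * x ^ (1 - β) * (8 * C * x ^ (1 / 2 - β))) =
      (3 * C) ^ (p - 2) * (24 * C ^ 2) * x ^ ((1 - β) * p - 1 / 2) := by
    have : x ^ ((1 - β) * p - 1 / 2) =
        x ^ ((1 - β) * (p - 2)) * x ^ (1 - β) * x ^ (1 / 2 - β) := by
      rw [← Real.rpow_add hx0, ← Real.rpow_add hx0]; congr 1; ring
    rw [this]; ring
  rw [hbound] at hmain
  rw [((continuous_expSum lam r F).memLp_uniformMeasure _ Y).eLpNorm_eq_integral_rpow_norm
    (by simpa using hp0) ENNReal.ofReal_ne_top, ENNReal.toReal_ofReal hp0.le]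
  refine ENNReal.ofReal_le_ofReal ?_
  rw [integral_uniformMeasure hY0, smul_eq_mul]
  have hnn : 0 ≤ Y⁻¹ * ∫ y in (0 : ℝ)..Y, ‖expSum lam r F y‖ ^ p :=
    mul_nonneg (by positivity) (intervalIntegral.integral_nonneg hY0.le fun y _ => by positivity)
  refine (Real.rpow_le_rpow hnn hmain (by positivity)).trans (le_of_eq ?_)
  rw [Real.mul_rpow (by positivity) (by positivity), ← Real.rpow_mul hx0.le, hx,
    ← Real.rpow_natCast 4 j, ← Real.rpow_mul (by norm_num), ← Real.rpow_mul_natCast (by norm_num)]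
  congr 2
  ring

lemma expSum_eq_sum_fiberwise (lam : ℕ → ℝ) (r : ℕ → ℂ) (F : Finset ℕ) (b : ℕ → ℕ) :
    expSum lam r F = ∑ j ∈ F.image b, expSum lam r (F.filter fun n => b n = j) := by
  funext y
  rw [Finset.sum_apply]
  exact (Finset.sum_fiberwise_of_maps_to (fun n hn => Finset.mem_image_of_mem b hn) _).symm

/-- The blocks `[4^j, 4^(j+1))` contribute geometrically decaying norms, so finite sums over
large frequencies are uniformly small in the `p`-th mean. -/
lemma exists_forall_eLpNorm_expSum_le {lam : ℕ → ℝ} {r : ℕ → ℂ} {T₀ C β p : ℝ} (hp : 2 ≤ p)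
    (hβ : 0 ≤ β) (hpβ : (1 - β) * p < 1 / 2) (hC : 0 ≤ C)
    (hmass : ∀ (F : Finset ℕ) (T : ℝ), T₀ ≤ T →
      ∑ n ∈ F with T ≤ lam n ∧ lam n ≤ T + 1, ‖r n‖ ≤ C * T ^ (-β))
    {ε : ℝ} (hε : 0 < ε) :
    ∃ N : ℝ, ∀ F : Finset ℕ, (∀ n ∈ F, N ≤ lam n) → ∀ Y : ℝ, 1 ≤ Y →
      eLpNorm (expSum lam r F) (ENNReal.ofReal p) (uniformMeasure Y) ≤ ENNReal.ofReal ε := by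
  have hp0 : 0 < p := by linarith
  set K : ℝ := ((3 * C) ^ (p - 2) * (24 * C ^ 2)) ^ p⁻¹
  set q : ℝ := (4 : ℝ) ^ (((1 - β) * p - 1 / 2) / p) with hq
  have hq0 : 0 ≤ q := by positivity
  have hq1 : q < 1 :=
    Real.rpow_lt_one_of_one_lt_of_neg (by norm_num) (div_neg_of_neg_of_pos (by linarith) hp0)
  have hsum : Summable fun j : ℕ => K * q ^ j :=
    (summable_geometric_of_lt_one hq0 hq1).mul_left K
  obtain ⟨s, hs⟩ := summable_iff_vanishing_norm.1 hsum ε hε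
  obtain ⟨j₁, hj₁⟩ := pow_unbounded_of_one_lt T₀ (by norm_num : (1 : ℝ) < 4)
  obtain ⟨j₂, hj₂⟩ := s.bddAbove
  set J := max j₁ (j₂ + 1)
  refine ⟨4 ^ J, fun F hF Y hY => ?_⟩
  have hb : ∀ n ∈ F, J ≤ Nat.log 4 ⌊lam n⌋₊ ∧
      4 ^ (Nat.log 4 ⌊lam n⌋₊) ≤ lam n ∧ lam n ≤ 4 ^ (Nat.log 4 ⌊lam n⌋₊ + 1) := by
    intro n hn
    have h0 : (0 : ℝ) ≤ lam n := le_trans (by positivity) (hF n hn)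
    have h1 : 4 ^ J ≤ ⌊lam n⌋₊ := by
      rw [Nat.le_floor_iff h0]; exact_mod_cast hF n hn
    have h2 : ⌊lam n⌋₊ ≠ 0 := by
      have := Nat.one_le_pow J 4 (by norm_num); omega
    refine ⟨Nat.le_log_of_pow_le (by norm_num) h1, ?_, ?_⟩
    · have := Nat.pow_log_le_self 4 h2
      rw [Nat.le_floor_iff h0] at this
      exact_mod_cast this
    · have := Nat.lt_pow_succ_log_self (by norm_num : 1 < 4) ⌊lam n⌋₊
      have h3 := (Nat.floor_lt h0).1 this
      exact_mod_cast h3.le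
  rw [expSum_eq_sum_fiberwise lam r F fun n => Nat.log 4 ⌊lam n⌋₊]
  have hone : (1 : ENNReal) ≤ ENNReal.ofReal p := by
    rw [ENNReal.one_le_ofReal]; linarith
  refine (eLpNorm_sum_le
    (fun j _ => (continuous_expSum lam r _).aestronglyMeasurable) hone).trans ?_
  have hterm : ∀ j ∈ F.image (fun n => Nat.log 4 ⌊lam n⌋₊),
      eLpNorm (expSum lam r (F.filter fun n => Nat.log 4 ⌊lam n⌋₊ = j)) (ENNReal.ofReal p)
        (uniformMeasure Y) ≤ ENNReal.ofReal (K * q ^ j) := by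
    intro j hj
    obtain ⟨m, hm, rfl⟩ := Finset.mem_image.1 hj
    refine eLpNorm_expSum_le_of_block hp hβ hC hmass ?_ ?_ hY
    · refine hj₁.le.trans (pow_le_pow_right₀ (by norm_num) ?_)
      exact (le_max_left _ _).trans (hb m hm).1
    · intro n hn
      rw [Finset.mem_filter] at hn
      rw [← hn.2]
      exact (hb n hn.1).2
  refine (Finset.sum_le_sum hterm).trans ?_
  rw [← ENNReal.ofReal_sum_of_nonneg fun j _ => by positivity]
  refine ENNReal.ofReal_le_ofReal ((le_abs_self _).trans (hs _ ?_).le)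
  rw [Finset.disjoint_left]
  intro j hj hjs
  obtain ⟨m, hm, rfl⟩ := Finset.mem_image.1 hj
  have h1 : j₂ + 1 ≤ _ := (le_max_right _ _).trans (hb m hm).1
  have h2 := hj₂ hjs
  omega

/-! ### Mean values of almost periodic functions -/

lemma exists_tendsto_of_forall_exists_approx {F : ℝ → ℂ}
    (h : ∀ ε : ℝ, 0 < ε → ∃ G : ℝ → ℂ, (∃ l, Tendsto G atTop (𝓝 l)) ∧
      ∀ᶠ Y in atTop, ‖F Y - G Y‖ ≤ ε) :
    ∃ l, Tendsto F atTop (𝓝 l) := by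
  refine cauchy_map_iff_exists_tendsto.1 (Metric.cauchy_iff.2 ⟨inferInstance, fun ε hε => ?_⟩)
  obtain ⟨G, ⟨l, hl⟩, hG⟩ := h (ε / 4) (by linarith)
  refine ⟨Metric.ball l (ε / 2), ?_, fun x hx y hy => ?_⟩
  · have h1 : ∀ᶠ Y in atTop, dist (G Y) l < ε / 4 := Metric.tendsto_nhds.1 hl _ (by linarith)
    rw [mem_map]
    filter_upwards [h1, hG] with Y hY1 hY2
    rw [← dist_eq_norm] at hY2
    have := dist_triangle (F Y) (G Y) l
    simp only [Set.mem_preimage, Metric.mem_ball]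
    linarith
  · rw [Metric.mem_ball] at hx hy
    have := dist_triangle_right x y l
    linarith

/-- The character `y ↦ e^{i a y}` as a bounded continuous function. -/
noncomputable def boundedExp (a : ℝ) : ℝ →ᵇ ℂ :=
  BoundedContinuousFunction.ofNormedAddCommGroup
    (fun y : ℝ => Complex.exp (Complex.I * (a : ℂ) * (y : ℂ))) (by fun_prop) 1
    (fun y => (norm_exp_I_mul_ofReal_mul_ofReal a y).le)

lemma boundedExp_apply (a y : ℝ) :
    boundedExp a y = Complex.exp (Complex.I * (a : ℂ) * (y : ℂ)) := rfl

lemma boundedExp_zero : boundedExp 0 = 1 := by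
  ext y
  simp [boundedExp_apply]

lemma boundedExp_add (a b : ℝ) : boundedExp (a + b) = boundedExp a * boundedExp b := by
  ext y
  simp only [boundedExp_apply, BoundedContinuousFunction.mul_apply, ← Complex.exp_add]
  congr 1
  push_cast
  ring

/-- The algebra of trigonometric polynomials; its topological closure is the algebra of uniformly
almost periodic functions. -/
noncomputable def trigPolynomials : Subalgebra ℂ (ℝ →ᵇ ℂ) :=
  Algebra.adjoin ℂ (Set.range boundedExp)

lemma BoundedContinuousFunction.integrable_uniformMeasure (f : ℝ →ᵇ ℂ) (Y : ℝ) :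
    Integrable f (uniformMeasure Y) :=
  memLp_one_iff_integrable.1 (f.continuous.memLp_uniformMeasure 1 Y)

lemma exists_tendsto_mean_boundedExp (a : ℝ) :
    ∃ l, Tendsto (fun Y => ∫ y, boundedExp a y ∂(uniformMeasure Y)) atTop (𝓝 l) := by
  rcases eq_or_ne a 0 with rfl | ha
  · refine ⟨1, tendsto_const_nhds.congr' ?_⟩
    filter_upwards [eventually_gt_atTop 0] with Y hY
    have := isProbabilityMeasure_uniformMeasure hY
    simp [boundedExp_zero]
  · refine ⟨0, squeeze_zero_norm' (a := fun Y : ℝ => Y⁻¹ * (2 / |a|)) ?_ ?_⟩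
    · filter_upwards [eventually_gt_atTop 0] with Y hY
      rw [integral_uniformMeasure hY, norm_smul, Real.norm_of_nonneg (by positivity)]
      exact mul_le_mul_of_nonneg_left (norm_integral_exp_le_two_div ha Y) (by positivity)
    · simpa using tendsto_inv_atTop_zero.mul_const (2 / |a|)

lemma exists_tendsto_mean_of_mem_trigPolynomials {f : ℝ →ᵇ ℂ} (hf : f ∈ trigPolynomials) :
    ∃ l, Tendsto (fun Y => ∫ y, f y ∂(uniformMeasure Y)) atTop (𝓝 l) := by
  have hf' : f ∈ Submodule.span ℂ (Set.range boundedExp) := by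
    have h1 : (Submonoid.closure (Set.range boundedExp) : Set (ℝ →ᵇ ℂ)) ⊆
        Set.range boundedExp := by
      intro x hx
      refine Submonoid.closure_induction (fun x hx => hx) ⟨0, boundedExp_zero⟩ ?_ hx
      rintro _ _ _ _ ⟨a, rfl⟩ ⟨b, rfl⟩
      exact ⟨a + b, boundedExp_add a b⟩
    have h2 : f ∈ Subalgebra.toSubmodule trigPolynomials := hf
    rw [trigPolynomials, Algebra.adjoin_eq_span] at h2
    exact Submodule.span_mono h1 h2
  clear hf
  induction hf' using Submodule.span_induction with
  | mem x hx =>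
    obtain ⟨a, rfl⟩ := hx
    exact exists_tendsto_mean_boundedExp a
  | zero => exact ⟨0, by simp⟩
  | add x y _ _ hx hy =>
    obtain ⟨l, hl⟩ := hx
    obtain ⟨m, hm⟩ := hy
    refine ⟨l + m, (hl.add hm).congr fun Y => ?_⟩
    exact (integral_add (x.integrable_uniformMeasure Y) (y.integrable_uniformMeasure Y)).symm
  | smul c x _ hx =>
    obtain ⟨l, hl⟩ := hx
    refine ⟨c • l, (hl.const_smul c).congr fun Y => ?_⟩
    exact (integral_smul c _).symm

lemma exists_tendsto_mean_of_mem_closure {f : ℝ →ᵇ ℂ}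
    (hf : f ∈ trigPolynomials.topologicalClosure) :
    ∃ l, Tendsto (fun Y => ∫ y, f y ∂(uniformMeasure Y)) atTop (𝓝 l) := by
  refine exists_tendsto_of_forall_exists_approx fun ε hε => ?_
  obtain ⟨g, hg, hfg⟩ := Metric.mem_closure_iff.1 hf ε hε
  refine ⟨_, exists_tendsto_mean_of_mem_trigPolynomials hg, ?_⟩
  filter_upwards [eventually_gt_atTop 0] with Y hY
  have := isProbabilityMeasure_uniformMeasure hY
  rw [← integral_sub (f.integrable_uniformMeasure Y) (g.integrable_uniformMeasure Y)]
  have h := norm_integral_le_of_norm_le_const (μ := uniformMeasure Y) (C := ε)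
    (f := fun y => f y - g y) (Eventually.of_forall fun y => ?_)
  · simpa using h
  · rw [← dist_eq_norm]
    exact (BoundedContinuousFunction.dist_coe_le_dist y).trans hfg.le

lemma exp_mem_topologicalClosure {f : ℝ →ᵇ ℂ} (hf : f ∈ trigPolynomials) :
    NormedSpace.exp f ∈ trigPolynomials.topologicalClosure := by
  have h := NormedSpace.exp_series_hasSum_exp' (𝕂 := ℂ) f
  refine trigPolynomials.isClosed_topologicalClosure.mem_of_tendsto h
    (Eventually.of_forall fun s => ?_)
  refine Subalgebra.sum_mem _ fun n _ => Subalgebra.smul_mem _ (Subalgebra.pow_mem _ ?_ _) _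
  exact trigPolynomials.le_topologicalClosure hf

lemma BoundedContinuousFunction.exp_apply (f : ℝ →ᵇ ℂ) (y : ℝ) :
    NormedSpace.exp f y = Complex.exp (f y) := by
  have h1 := (NormedSpace.exp_series_hasSum_exp' (𝕂 := ℂ) f).mapL
    (BoundedContinuousFunction.evalCLM ℂ y)
  have h2 := NormedSpace.exp_series_hasSum_exp' (𝕂 := ℂ) (f y)
  rw [Complex.exp_eq_exp_ℂ]
  refine h1.unique (h2.congr_fun fun n => ?_)
  simp

/-- The real part of an exponential sum, as a trigonometric polynomial. -/
lemma exists_mem_trigPolynomials_re_expSum (lam : ℕ → ℝ) (r : ℕ → ℂ) (F : Finset ℕ) :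
    ∃ f ∈ trigPolynomials, ∀ y, f y = ((expSum lam r F y).re : ℂ) := by
  refine ⟨∑ n ∈ F, ((r n / 2) • boundedExp (lam n) +
    ((starRingEnd ℂ) (r n) / 2) • boundedExp (-lam n)), ?_, fun y => ?_⟩
  · have h : ∀ a, boundedExp a ∈ trigPolynomials := fun a => Algebra.subset_adjoin ⟨a, rfl⟩
    exact Subalgebra.sum_mem _ fun n _ => Subalgebra.add_mem _
      (Subalgebra.smul_mem _ (h _) _) (Subalgebra.smul_mem _ (h _) _)
  · rw [Complex.re_eq_add_conj, expSum, map_sum, ← Finset.sum_add_distrib, Finset.sum_div]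
    rw [BoundedContinuousFunction.sum_apply]
    refine Finset.sum_congr rfl fun n _ => ?_
    simp only [BoundedContinuousFunction.add_apply, BoundedContinuousFunction.smul_apply,
      boundedExp_apply, map_mul, ← Complex.exp_conj, Complex.conj_I, Complex.conj_ofReal,
      smul_eq_mul]
    push_cast
    ring_nf

/-- For a trigonometric polynomial `P`, the function `e^{itP}` is almost periodic, so it has a
mean value. -/
lemma exists_tendsto_mean_exp_re_expSum (lam : ℕ → ℝ) (r : ℕ → ℂ) (F : Finset ℕ) (t : ℝ) :
    ∃ l, Tendsto (fun Y => ∫ y, Complex.exp (t * ((expSum lam r F y).re : ℂ) * Complex.I)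
      ∂(uniformMeasure Y)) atTop (𝓝 l) := by
  obtain ⟨f, hf, hfe⟩ := exists_mem_trigPolynomials_re_expSum lam r F
  obtain ⟨l, hl⟩ := exists_tendsto_mean_of_mem_closure
    (exp_mem_topologicalClosure (trigPolynomials.smul_mem hf (t * Complex.I)))
  refine ⟨l, hl.congr fun Y => integral_congr_ae (Eventually.of_forall fun y => ?_)⟩
  simp only [BoundedContinuousFunction.exp_apply, BoundedContinuousFunction.smul_apply, hfe,
    smul_eq_mul]
  congr 1
  ring

/-! ### Functions approximable by trigonometric polynomials in the mean -/

/-- `φ` is locally in `L^p`, and it can be approximated in the `p`-th mean over `[0, Y]`, for large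
`Y`, by real parts of exponential sums with the given frequencies and coefficients: `φ` is almost
periodic in the sense of Besicovitch. -/
structure IsMeanApproximable (φ : ℝ → ℝ) (p : ℝ) (lam : ℕ → ℝ) (r : ℕ → ℂ) : Prop where
  memLp : ∀ Y, MemLp φ (ENNReal.ofReal p) (volume.restrict (Set.Ioc 0 Y))
  approx : ∀ ε : ℝ, 0 < ε → ∃ F : Finset ℕ, ∀ᶠ Y in atTop,
    eLpNorm (fun y => φ y - (expSum lam r F y).re) (ENNReal.ofReal p) (uniformMeasure Y) ≤
      ENNReal.ofReal ε

lemma continuous_re_expSum (lam : ℕ → ℝ) (r : ℕ → ℂ) (F : Finset ℕ) :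
    Continuous fun y => (expSum lam r F y).re :=
  Complex.continuous_re.comp (continuous_expSum lam r F)

lemma abs_re_expSum_le (lam : ℕ → ℝ) (r : ℕ → ℂ) (F : Finset ℕ) (y : ℝ) :
    |(expSum lam r F y).re| ≤ ∑ n ∈ F, ‖r n‖ :=
  (Complex.abs_re_le_norm _).trans (norm_expSum_le lam r F y)

namespace IsMeanApproximable

variable {φ : ℝ → ℝ} {p : ℝ} {lam : ℕ → ℝ} {r : ℕ → ℂ}

lemma memLp_uniformMeasure (h : IsMeanApproximable φ p lam r) (Y : ℝ) :
    MemLp φ (ENNReal.ofReal p) (uniformMeasure Y) :=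
  (h.memLp Y).smul_measure ENNReal.ofReal_ne_top

lemma aestronglyMeasurable (h : IsMeanApproximable φ p lam r) (Y : ℝ) :
    AEStronglyMeasurable φ (uniformMeasure Y) := (h.memLp_uniformMeasure Y).aestronglyMeasurable

lemma integrable_sub (h : IsMeanApproximable φ p lam r) (hp : 1 ≤ p) (F : Finset ℕ) {Y : ℝ}
    (hY : 0 < Y) : Integrable (fun y => φ y - (expSum lam r F y).re) (uniformMeasure Y) := by
  have := isProbabilityMeasure_uniformMeasure hY
  have h1 := (h.memLp_uniformMeasure Y).sub ((continuous_re_expSum lam r F).memLp_uniformMeasure _ Y)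
  exact h1.integrable (by rwa [ENNReal.one_le_ofReal])

lemma integral_norm_sub_le (h : IsMeanApproximable φ p lam r) (hp : 1 ≤ p) {F : Finset ℕ}
    {Y ε : ℝ} (hY : 0 < Y) (hε : 0 ≤ ε)
    (hF : eLpNorm (fun y => φ y - (expSum lam r F y).re) (ENNReal.ofReal p) (uniformMeasure Y) ≤
      ENNReal.ofReal ε) :
    ∫ y, |φ y - (expSum lam r F y).re| ∂(uniformMeasure Y) ≤ ε := by
  have := isProbabilityMeasure_uniformMeasure hY
  have hi := h.integrable_sub hp F hY
  have h1 := (eLpNorm_le_eLpNorm_of_exponent_le (p := 1) (q := ENNReal.ofReal p)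
    (by rwa [ENNReal.one_le_ofReal]) hi.aestronglyMeasurable).trans hF
  rw [eLpNorm_one_eq_lintegral_enorm, ← ofReal_integral_norm_eq_lintegral_enorm hi] at h1
  exact (ENNReal.ofReal_le_ofReal_iff hε).1 h1

lemma aemeasurable (h : IsMeanApproximable φ p lam r) (Y : ℝ) :
    AEMeasurable φ (uniformMeasure Y) := (h.memLp_uniformMeasure Y).aestronglyMeasurable.aemeasurable

/-- The mean values of `e^{itφ}` converge. -/
lemma exists_tendsto_mean_exp (h : IsMeanApproximable φ p lam r) (hp : 1 ≤ p) (t : ℝ) :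
    ∃ l, Tendsto (fun Y => ∫ y, Complex.exp (t * (φ y : ℂ) * Complex.I) ∂(uniformMeasure Y))
      atTop (𝓝 l) := by
  refine exists_tendsto_of_forall_exists_approx fun ε hε => ?_
  obtain ⟨F, hF⟩ := h.approx (ε / (|t| + 1)) (by positivity)
  refine ⟨_, exists_tendsto_mean_exp_re_expSum lam r F t, ?_⟩
  filter_upwards [hF, eventually_gt_atTop 0] with Y hFY hY
  have := isProbabilityMeasure_uniformMeasure hY
  have hnorm : ∀ a : ℝ, ‖Complex.exp (t * (a : ℂ) * Complex.I)‖ = 1 := fun a => by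
    rw [← Complex.ofReal_mul, Complex.norm_exp_ofReal_mul_I]
  have hcont : Continuous fun a : ℝ => Complex.exp (t * (a : ℂ) * Complex.I) := by fun_prop
  have hint : ∀ f : ℝ → ℝ, AEStronglyMeasurable f (uniformMeasure Y) →
      Integrable (fun y => Complex.exp (t * (f y : ℂ) * Complex.I)) (uniformMeasure Y) :=
    fun f hf => Integrable.of_bound (hcont.comp_aestronglyMeasurable hf) 1
      (Eventually.of_forall fun y => (hnorm _).le)
  rw [← integral_sub (hint _ (h.aestronglyMeasurable Y))
    (hint _ (continuous_re_expSum lam r F).aestronglyMeasurable)]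
  have hlip : ∀ a b : ℝ, ‖Complex.exp (t * (a : ℂ) * Complex.I) -
      Complex.exp (t * (b : ℂ) * Complex.I)‖ ≤ |t| * |a - b| := by
    intro a b
    have h1 : Complex.exp (t * (a : ℂ) * Complex.I) - Complex.exp (t * (b : ℂ) * Complex.I) =
        Complex.exp (t * (b : ℂ) * Complex.I) *
          (Complex.exp (Complex.I * ((t * (a - b) : ℝ) : ℂ)) - 1) := by
      rw [mul_sub, ← Complex.exp_add, mul_one]
      congr 2
      push_cast
      ring
    rw [h1, norm_mul, hnorm, one_mul, ← abs_mul]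
    exact Real.norm_exp_I_mul_ofReal_sub_one_le
  calc _ ≤ ∫ y, |t| * |φ y - (expSum lam r F y).re| ∂(uniformMeasure Y) :=
        norm_integral_le_of_norm_le ((h.integrable_sub hp F hY).abs.const_mul _)
          (Eventually.of_forall fun y => hlip _ _)
    _ = |t| * ∫ y, |φ y - (expSum lam r F y).re| ∂(uniformMeasure Y) := integral_const_mul _ _
    _ ≤ |t| * (ε / (|t| + 1)) := by
        gcongr
        exact h.integral_norm_sub_le hp hY (by positivity) hFY
    _ ≤ ε := by
        rw [mul_div_assoc', div_le_iff₀ (by positivity)]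
        nlinarith [abs_nonneg t]

lemma exists_eventually_integral_abs_le (h : IsMeanApproximable φ p lam r) (hp : 1 ≤ p) :
    ∃ B : ℝ, 0 ≤ B ∧ ∀ᶠ Y in atTop, ∫ y, |φ y| ∂(uniformMeasure Y) ≤ B := by
  obtain ⟨F, hF⟩ := h.approx 1 one_pos
  refine ⟨1 + ∑ n ∈ F, ‖r n‖, by positivity, ?_⟩
  filter_upwards [hF, eventually_gt_atTop 0] with Y hFY hY
  have := isProbabilityMeasure_uniformMeasure hY
  have hi := (h.integrable_sub hp F hY).abs
  calc ∫ y, |φ y| ∂(uniformMeasure Y)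
      ≤ ∫ y, (|φ y - (expSum lam r F y).re| + ∑ n ∈ F, ‖r n‖) ∂(uniformMeasure Y) := by
        refine integral_mono_of_nonneg (Eventually.of_forall fun y => abs_nonneg _)
          (hi.add (integrable_const _)) (Eventually.of_forall fun y => ?_)
        have h1 := abs_re_expSum_le lam r F y
        have h2 := abs_sub_abs_le_abs_sub (φ y) (expSum lam r F y).re
        simp only
        linarith
    _ = ∫ y, |φ y - (expSum lam r F y).re| ∂(uniformMeasure Y) + ∑ n ∈ F, ‖r n‖ := by
        rw [integral_add hi (integrable_const _)]
        simp
    _ ≤ _ := by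
        have := h.integral_norm_sub_le hp hY zero_le_one hFY
        linarith

/-! ### Convergence of the laws -/

/-- The law of `φ` under the uniform distribution on `[0, Y]`; for `Y ≤ 0`, where there is no such
law, it is the point mass at `0`. -/
noncomputable def law (h : IsMeanApproximable φ p lam r) (Y : ℝ) : ProbabilityMeasure ℝ :=
  ⟨if 0 < Y then (uniformMeasure Y).map φ else Measure.dirac 0, by
    split_ifs with hY
    · have := isProbabilityMeasure_uniformMeasure hY
      exact Measure.isProbabilityMeasure_map (h.aemeasurable Y)
    · infer_instance⟩

lemma coe_law (h : IsMeanApproximable φ p lam r) {Y : ℝ} (hY : 0 < Y) :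
    (h.law Y : Measure ℝ) = (uniformMeasure Y).map φ :=
  if_pos hY

lemma charFun_law (h : IsMeanApproximable φ p lam r) {Y : ℝ} (hY : 0 < Y) (t : ℝ) :
    charFun (h.law Y : Measure ℝ) t =
      ∫ y, Complex.exp (t * (φ y : ℂ) * Complex.I) ∂(uniformMeasure Y) := by
  rw [charFun_apply_real, h.coe_law hY, integral_map (h.aemeasurable Y)]
  exact Continuous.aestronglyMeasurable (by fun_prop)

/-- By Markov's inequality the laws of `φ` are tight. -/
lemma exists_isTightMeasureSet (h : IsMeanApproximable φ p lam r) (hp : 1 ≤ p) :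
    ∃ Y₀ : ℝ, 0 < Y₀ ∧ IsTightMeasureSet {μ | ∃ Y, Y₀ ≤ Y ∧ μ = (h.law Y : Measure ℝ)} := by
  obtain ⟨B, hB0, hB⟩ := h.exists_eventually_integral_abs_le hp
  obtain ⟨Y₀, hY₀⟩ := eventually_atTop.1 (hB.and (eventually_gt_atTop 0))
  refine ⟨Y₀, (hY₀ Y₀ le_rfl).2, isTightMeasureSet_of_tendsto_measure_norm_gt ?_⟩
  have hlim : Tendsto (fun R : ℝ => ENNReal.ofReal (B / R)) atTop (𝓝 0) := by
    rw [← ENNReal.ofReal_zero]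
    exact ENNReal.tendsto_ofReal (tendsto_const_nhds.div_atTop tendsto_id)
  refine tendsto_of_tendsto_of_tendsto_of_le_of_le' tendsto_const_nhds hlim
    (Eventually.of_forall fun _ => zero_le) ?_
  filter_upwards [eventually_gt_atTop 0] with R hR
  refine iSup₂_le ?_
  rintro _ ⟨Y, hY, rfl⟩
  obtain ⟨hBY, hY0⟩ := hY₀ Y hY
  rw [h.coe_law hY0]
  have := isProbabilityMeasure_uniformMeasure hY0
  have hi : Integrable φ (uniformMeasure Y) :=
    (h.memLp_uniformMeasure Y).integrable (by rwa [ENNReal.one_le_ofReal])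
  have hmarkov := mul_meas_ge_le_lintegral₀ (μ := (uniformMeasure Y).map φ) (f := fun x : ℝ => ‖x‖ₑ)
    (by fun_prop) (ENNReal.ofReal R)
  have hlint : ∫⁻ x, ‖x‖ₑ ∂((uniformMeasure Y).map φ) ≤ ENNReal.ofReal B := by
    rw [lintegral_map' (by fun_prop) (h.aemeasurable Y),
      ← ofReal_integral_norm_eq_lintegral_enorm hi]
    exact ENNReal.ofReal_le_ofReal hBY
  rw [ENNReal.ofReal_div_of_pos hR, ENNReal.le_div_iff_mul_le (by simp [hR]) (by simp), mul_comm]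
  refine le_trans ?_ (hmarkov.trans hlint)
  gcongr with x
  intro hx
  rw [← ofReal_norm]
  exact ENNReal.ofReal_le_ofReal (le_of_lt hx)

/-- Some probability measure has as characteristic function the limit of those of the laws of
`φ`: a cluster point of the laws, which exists by Prokhorov's theorem. -/
lemma exists_forall_tendsto_charFun (h : IsMeanApproximable φ p lam r) (hp : 1 ≤ p) :
    ∃ μ : ProbabilityMeasure ℝ, ∀ t,
      Tendsto (fun Y => charFun (h.law Y : Measure ℝ) t) atTop
        (𝓝 (charFun (μ : Measure ℝ) t)) := by
  obtain ⟨Y₀, hY₀, htight⟩ := h.exists_isTightMeasureSet hp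
  have hcomp : IsCompact (closure {μ | ∃ Y, Y₀ ≤ Y ∧ μ = h.law Y}) := by
    refine isCompact_closure_of_isTightMeasureSet (htight.subset ?_)
    rintro _ ⟨_, ⟨Y, hY, rfl⟩, rfl⟩
    exact ⟨Y, hY, rfl⟩
  obtain ⟨μ, -, hμ⟩ := hcomp.exists_mapClusterPt (f := atTop) (u := h.law)
    (tendsto_principal.2 ((eventually_ge_atTop Y₀).mono fun Y hY => subset_closure ⟨Y, hY, rfl⟩))
  refine ⟨μ, fun t => ?_⟩
  obtain ⟨l, hl⟩ := h.exists_tendsto_mean_exp hp t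
  replace hl : Tendsto (fun Y => charFun (h.law Y : Measure ℝ) t) atTop (𝓝 l) :=
    hl.congr' ((eventually_gt_atTop 0).mono fun Y hY => (h.charFun_law hY t).symm)
  have hcont : Continuous fun ρ : ProbabilityMeasure ℝ => charFun (ρ : Measure ℝ) t := by
    refine continuous_iff_continuousAt.2 fun ρ => ?_
    have h1 := (ProbabilityMeasure.tendsto_iff_forall_integral_rclike_tendsto ℂ
      (F := 𝓝 ρ) (μs := id)).1 tendsto_id
    have h2 := h1 (BoundedContinuousFunction.innerProbChar t)
    simpa only [ContinuousAt, charFun_eq_integral_innerProbChar] using! h2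
  have hclus : MapClusterPt (charFun (μ : Measure ℝ) t) atTop
      (fun Y => charFun (h.law Y : Measure ℝ) t) :=
    hμ.continuousAt_comp hcont.continuousAt
  have hne : (𝓝 (charFun (μ : Measure ℝ) t) ⊓ 𝓝 l).NeBot :=
    NeBot.mono hclus (inf_le_inf_left _ hl)
  rwa [eq_of_nhds_neBot hne]

/-- The laws of `φ` converge: Lévy's theorem, applied along sequences. -/
lemma exists_tendsto_law (h : IsMeanApproximable φ p lam r) (hp : 1 ≤ p) :
    ∃ μ : ProbabilityMeasure ℝ, Tendsto h.law atTop (𝓝 μ) := by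
  obtain ⟨μ, hμ⟩ := h.exists_forall_tendsto_charFun hp
  exact ⟨μ, tendsto_of_seq_tendsto fun y hy =>
    ProbabilityMeasure.tendsto_iff_tendsto_charFun.2 fun t => (hμ t).comp hy⟩

lemma tendsto_integral_of_tendsto_law (h : IsMeanApproximable φ p lam r)
    {μ : ProbabilityMeasure ℝ} (hμ : Tendsto h.law atTop (𝓝 μ)) (g : ℝ →ᵇ ℝ) :
    Tendsto (fun Y => ∫ y, g (φ y) ∂(uniformMeasure Y)) atTop (𝓝 (∫ x, g x ∂μ)) := by
  refine (ProbabilityMeasure.tendsto_iff_forall_integral_tendsto.1 hμ g).congr' ?_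
  filter_upwards [eventually_gt_atTop 0] with Y hY
  rw [h.coe_law hY]
  exact integral_map (h.aemeasurable Y) g.continuous.aestronglyMeasurable

/-! ### Moments -/

/-- The error made by truncating `x ^ n` at height `R`. -/
noncomputable def truncationError (n : ℕ) (R x : ℝ) : ℝ := |x ^ n - max (-R) (min x R) ^ n|

lemma continuous_truncationError (n : ℕ) (R : ℝ) : Continuous (truncationError n R) := by
  unfold truncationError
  fun_prop

lemma truncationError_of_abs_le (n : ℕ) {R x : ℝ} (hx : |x| ≤ R) : truncationError n R x = 0 := by
  rw [abs_le] at hx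
  rw [truncationError, min_eq_left hx.2, max_eq_right hx.1, sub_self, abs_zero]

lemma truncationError_le_abs_pow (n : ℕ) {R x : ℝ} (hR : 0 ≤ R) (hx : R < |x|) :
    truncationError n R x ≤ |x| ^ n := by
  have hpow : R ^ n ≤ |x| ^ n := by gcongr
  have hR0 : 0 ≤ R ^ n := by positivity
  rcases lt_abs.1 hx with h | h
  · rw [truncationError, min_eq_right h.le, max_eq_right (by linarith)]
    rw [abs_of_pos (by linarith : 0 < x)] at hpow ⊢
    rw [abs_of_nonneg (by linarith)]
    linarith
  · rw [truncationError, min_eq_left (by linarith), max_eq_left (by linarith)]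
    have h1 : x ^ n - (-R) ^ n = (-1) ^ n * (|x| ^ n - R ^ n) := by
      rw [abs_of_neg (by linarith : x < 0), mul_sub, ← mul_pow, ← mul_pow]
      simp
    rw [h1, abs_mul, abs_pow, abs_neg, abs_one, one_pow, one_mul, abs_of_nonneg (by linarith)]
    linarith

/-- The error vanishes unless `|u| > R`. In that case `|u|` exceeds twice the bound `K` for `|v|`, so
that `|u| ≤ 2 |u - v|`. -/
lemma truncationError_le (n : ℕ) {R K u v : ℝ} (hp : 0 ≤ p) (hn : (n : ℝ) ≤ p) (hR1 : 1 ≤ R)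
    (hRK : 2 * K ≤ R) (hv : |v| ≤ K) :
    truncationError n R u ≤ 2 ^ p * |u - v| ^ p := by
  rcases le_or_gt |u| R with hu | hu
  · rw [truncationError_of_abs_le n hu]
    positivity
  · have h2 : |u| ≤ 2 * |u - v| := by
      have := abs_sub_abs_le_abs_sub u v
      linarith
    calc _ ≤ |u| ^ n := truncationError_le_abs_pow n (by linarith) hu
      _ = |u| ^ (n : ℝ) := (Real.rpow_natCast _ _).symm
      _ ≤ |u| ^ p := Real.rpow_le_rpow_of_exponent_le (by linarith) hn
      _ ≤ (2 * |u - v|) ^ p := Real.rpow_le_rpow (abs_nonneg _) h2 hp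
      _ = _ := Real.mul_rpow (by norm_num) (abs_nonneg _)

/-- Uniform integrability of `φ ^ n` for `n ≤ p`: the large values of `φ` come from the difference
to a bounded trigonometric polynomial, which is small in the `p`-th mean. -/
lemma exists_eventually_lintegral_truncationError_le (h : IsMeanApproximable φ p lam r)
    (hp : 1 ≤ p) {n : ℕ} (hn : (n : ℝ) ≤ p) {ε : ℝ} (hε : 0 < ε) :
    ∃ R : ℝ, 0 ≤ R ∧ ∀ᶠ Y in atTop,
      ∫⁻ y, ENNReal.ofReal (truncationError n R (φ y)) ∂(uniformMeasure Y) ≤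
        ENNReal.ofReal ε := by
  have hp0 : 0 < p := by linarith
  obtain ⟨F, hF⟩ := h.approx (ε ^ p⁻¹ / 2) (by positivity)
  refine ⟨max 1 (2 * ∑ n ∈ F, ‖r n‖), zero_le_one.trans (le_max_left _ _), ?_⟩
  filter_upwards [hF] with Y hFY
  set d : ℝ → ℝ := fun y => φ y - (expSum lam r F y).re
  have hpow : ∫⁻ y, ‖d y‖ₑ ^ p ∂(uniformMeasure Y) ≤ ENNReal.ofReal (ε ^ p⁻¹ / 2) ^ p := by
    have h1 := eLpNorm_eq_lintegral_rpow_enorm_toReal (μ := uniformMeasure Y) (f := d)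
      (p := ENNReal.ofReal p) (by simpa using hp0) ENNReal.ofReal_ne_top
    rw [ENNReal.toReal_ofReal hp0.le] at h1
    rw [h1] at hFY
    have h2 := ENNReal.rpow_le_rpow hFY hp0.le
    rwa [← ENNReal.rpow_mul, one_div, inv_mul_cancel₀ hp0.ne', ENNReal.rpow_one] at h2
  calc ∫⁻ y, ENNReal.ofReal (truncationError n _ (φ y)) ∂(uniformMeasure Y)
      ≤ ∫⁻ y, ENNReal.ofReal (2 ^ p) * ‖d y‖ₑ ^ p ∂(uniformMeasure Y) := by
        refine lintegral_mono fun y => ?_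
        rw [← ofReal_norm, ENNReal.ofReal_rpow_of_nonneg (norm_nonneg _) hp0.le,
          ← ENNReal.ofReal_mul (by positivity)]
        exact ENNReal.ofReal_le_ofReal (truncationError_le n hp0.le hn (le_max_left _ _)
          (le_max_right _ _) (abs_re_expSum_le lam r F y))
    _ = ENNReal.ofReal (2 ^ p) * ∫⁻ y, ‖d y‖ₑ ^ p ∂(uniformMeasure Y) :=
        lintegral_const_mul' _ _ ENNReal.ofReal_ne_top
    _ ≤ ENNReal.ofReal (2 ^ p) * ENNReal.ofReal (ε ^ p⁻¹ / 2) ^ p := by gcongr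
    _ = ENNReal.ofReal ε := by
        rw [ENNReal.ofReal_rpow_of_nonneg (by positivity) hp0.le,
          ← ENNReal.ofReal_mul (by positivity), ← Real.mul_rpow (by norm_num) (by positivity),
          mul_div_cancel₀ _ (by norm_num), ← Real.rpow_mul hε.le, inv_mul_cancel₀ hp0.ne',
          Real.rpow_one]

/-- The truncated power `x ↦ (clamp of x to [-R, R]) ^ n`. -/
noncomputable def truncatedPow (n : ℕ) {R : ℝ} (hR : 0 ≤ R) : ℝ →ᵇ ℝ :=
  BoundedContinuousFunction.ofNormedAddCommGroup (fun x : ℝ => max (-R) (min x R) ^ n)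
    (by fun_prop) (R ^ n) fun x => by
      rw [norm_pow]
      gcongr
      rw [Real.norm_eq_abs, abs_le]
      exact ⟨le_max_left _ _, max_le (by linarith) (min_le_right _ _)⟩

/-- If the truncation error has small integral, the `n`-th moment exists and is close to the
truncated moment. -/
lemma integrable_pow_and_abs_integral_sub_le {ρ : Measure ℝ} [IsFiniteMeasure ρ] {f : ℝ → ℝ}
    (hf : AEMeasurable f ρ) {n : ℕ} {R ε : ℝ} (hR : 0 ≤ R) (hε : 0 ≤ ε)
    (hle : ∫⁻ x, ENNReal.ofReal (truncationError n R (f x)) ∂ρ ≤ ENNReal.ofReal ε) :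
    Integrable (fun x => f x ^ n) ρ ∧
      |∫ x, f x ^ n ∂ρ - ∫ x, truncatedPow n hR (f x) ∂ρ| ≤ ε := by
  have hT : Integrable (fun x => truncatedPow n hR (f x)) ρ :=
    Integrable.of_bound
      ((truncatedPow n hR).continuous.comp_aestronglyMeasurable hf.aestronglyMeasurable)
      ‖truncatedPow n hR‖ (Eventually.of_forall fun x =>
        BoundedContinuousFunction.norm_coe_le_norm _ _)
  have henorm : ∀ x, ‖f x ^ n - truncatedPow n hR (f x)‖ₑ =
      ENNReal.ofReal (truncationError n R (f x)) := fun x => by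
    rw [← ofReal_norm]; rfl
  have hD : Integrable (fun x => f x ^ n - truncatedPow n hR (f x)) ρ := by
    refine ⟨(hf.pow_const n).aestronglyMeasurable.sub hT.aestronglyMeasurable, ?_⟩
    rw [HasFiniteIntegral]
    simp_rw [henorm]
    exact hle.trans_lt ENNReal.ofReal_lt_top
  have hP : Integrable (fun x => f x ^ n) ρ := by
    refine (hD.add hT).congr (Eventually.of_forall fun x => ?_)
    simp
  refine ⟨hP, ?_⟩
  rw [← integral_sub hP hT]
  rw [← Real.norm_eq_abs]
  refine (norm_integral_le_integral_norm _).trans ?_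
  rw [← ENNReal.ofReal_le_ofReal_iff hε, ofReal_integral_norm_eq_lintegral_enorm hD]
  simp_rw [henorm]
  exact hle

lemma lintegral_truncationError_le_of_tendsto_law (h : IsMeanApproximable φ p lam r)
    {μ : ProbabilityMeasure ℝ}
    (hμ : Tendsto h.law atTop (𝓝 μ)) {n : ℕ} {R ε : ℝ}
    (hle : ∀ᶠ Y in atTop, ∫⁻ y, ENNReal.ofReal (truncationError n R (φ y)) ∂(uniformMeasure Y) ≤
        ENNReal.ofReal ε) :
    ∫⁻ x, ENNReal.ofReal (truncationError n R x) ∂(μ : Measure ℝ) ≤ ENNReal.ofReal ε := by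
  have hy : Tendsto (fun k : ℕ => (k : ℝ) + 1) atTop atTop :=
    tendsto_atTop_add_const_right _ _ tendsto_natCast_atTop_atTop
  refine (lintegral_le_liminf_lintegral_of_forall_isOpen_measure_le_liminf_measure
    (μs := fun k : ℕ => (h.law (k + 1) : Measure ℝ)) (continuous_truncationError n R)
    (fun x => abs_nonneg _)
    fun G hG => ProbabilityMeasure.le_liminf_measure_open_of_tendsto (hμ.comp hy) hG).trans ?_
  refine liminf_le_of_frequently_le' (Eventually.frequently ?_)
  filter_upwards [hy.eventually hle] with k hk
  have hm : Measurable fun x => ENNReal.ofReal (truncationError n R x) :=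
    (ENNReal.continuous_ofReal.comp (continuous_truncationError n R)).measurable
  rw [h.coe_law (by positivity), lintegral_map' hm.aemeasurable (h.aemeasurable _)]
  exact hk

/-- Convergence of moments: the truncated moments converge by convergence in law, and the
truncation errors are uniformly small. -/
lemma integrable_pow_and_tendsto_integral_pow (h : IsMeanApproximable φ p lam r) (hp : 1 ≤ p)
    {μ : ProbabilityMeasure ℝ}
    (hμ : Tendsto h.law atTop (𝓝 μ)) {n : ℕ} (hn : (n : ℝ) ≤ p) :
    Integrable (fun x : ℝ => x ^ n) (μ : Measure ℝ) ∧
      Tendsto (fun Y => ∫ y, φ y ^ n ∂(uniformMeasure Y)) atTop (𝓝 (∫ x, x ^ n ∂μ)) := by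
  have key : ∀ ε : ℝ, 0 < ε → ∃ R, ∃ hR : 0 ≤ R, Integrable (fun x : ℝ => x ^ n) (μ : Measure ℝ) ∧
      |∫ x, x ^ n ∂(μ : Measure ℝ) - ∫ x, truncatedPow n hR x ∂(μ : Measure ℝ)| ≤ ε ∧
      ∀ᶠ Y in atTop, |∫ y, φ y ^ n ∂(uniformMeasure Y) -
        ∫ y, truncatedPow n hR (φ y) ∂(uniformMeasure Y)| ≤ ε := by
    intro ε hε
    obtain ⟨R, hR, hle⟩ := h.exists_eventually_lintegral_truncationError_le hp hn hε
    obtain ⟨h1, h2⟩ := integrable_pow_and_abs_integral_sub_le (f := fun x => x) aemeasurable_id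
      hR hε.le (h.lintegral_truncationError_le_of_tendsto_law hμ hle)
    refine ⟨R, hR, h1, h2, ?_⟩
    filter_upwards [hle, eventually_gt_atTop 0] with Y hY hY0
    have := isProbabilityMeasure_uniformMeasure hY0
    exact (integrable_pow_and_abs_integral_sub_le (h.aemeasurable Y) hR hε.le hY).2
  refine ⟨(key 1 one_pos).choose_spec.choose_spec.1, Metric.tendsto_nhds.2 fun ε hε => ?_⟩
  obtain ⟨R, hR, -, h2, h3⟩ := key (ε / 4) (by linarith)
  have h4 := Metric.tendsto_nhds.1
    (h.tendsto_integral_of_tendsto_law hμ (truncatedPow n hR)) (ε / 4) (by linarith)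
  filter_upwards [h3, h4] with Y hY3 hY4
  rw [Real.dist_eq] at hY4 ⊢
  rw [abs_le] at h2 hY3
  rw [abs_lt] at hY4 ⊢
  constructor <;> linarith [h2.1, h2.2, hY3.1, hY3.2, hY4.1, hY4.2]

end IsMeanApproximable

/-! ### `(p, β)`-functions are approximable in the mean -/

lemma finite_setOf_apply_le {lam : ℕ → ℝ} (h : Tendsto lam atTop atTop) (X : ℝ) :
    {n | lam n ≤ X}.Finite := by
  have h1 := h.eventually_gt_atTop X
  rw [← Nat.cofinite_eq_atTop, eventually_cofinite] at h1
  simpa only [not_lt] using h1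

lemma trigSum_eq_expSum {lam : ℕ → ℝ} (r : ℕ → ℂ) (hpos : ∀ n, 0 < lam n)
    (h : Tendsto lam atTop atTop) (y X : ℝ) :
    trigSum lam r y X = expSum lam r (finite_setOf_apply_le h X).toFinset y := by
  rw [trigSum, expSum, ← finsum_mem_eq_finite_toFinset_sum]
  congr 2
  ext n
  simp [hpos n]

lemma sum_norm_filter_le_coeffMass {lam : ℕ → ℝ} (r : ℕ → ℂ) (h : Tendsto lam atTop atTop)
    (F : Finset ℕ) (T : ℝ) :
    ∑ n ∈ F with T ≤ lam n ∧ lam n ≤ T + 1, ‖r n‖ ≤ coeffMass lam r T := by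
  have hfin : {n : ℕ | T ≤ lam n ∧ lam n ≤ T + 1}.Finite :=
    (finite_setOf_apply_le h (T + 1)).subset fun n hn => hn.2
  rw [coeffMass, finsum_mem_eq_finite_toFinset_sum _ hfin]
  refine Finset.sum_le_sum_of_subset_of_nonneg (fun n hn => ?_) fun _ _ _ => norm_nonneg _
  simp only [Finset.mem_filter] at hn
  simpa using hn.2

lemma exists_sum_norm_filter_le {lam : ℕ → ℝ} {r : ℕ → ℂ} {β : ℝ} (h : Tendsto lam atTop atTop)
    (hO : (fun T : ℝ => coeffMass lam r T) =O[atTop] (fun T : ℝ => 1 / T ^ β)) :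
    ∃ T₀ C : ℝ, 0 ≤ C ∧ ∀ (F : Finset ℕ) (T : ℝ), T₀ ≤ T →
      ∑ n ∈ F with T ≤ lam n ∧ lam n ≤ T + 1, ‖r n‖ ≤ C * T ^ (-β) := by
  obtain ⟨C, hC, hbound⟩ := hO.exists_pos
  obtain ⟨T₀, hT₀⟩ := eventually_atTop.1 (hbound.bound.and (eventually_gt_atTop 0))
  refine ⟨T₀, C, hC.le, fun F T hT => (sum_norm_filter_le_coeffMass r h F T).trans ?_⟩
  obtain ⟨h1, h2⟩ := hT₀ T hT
  refine (le_abs_self _).trans (h1.trans (le_of_eq ?_))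
  rw [Real.norm_of_nonneg (by positivity), Real.rpow_neg h2.le, one_div]

lemma eLpNorm_uniformMeasure (f : ℝ → ℝ) {p : ℝ} (hp : 0 < p) (Y : ℝ) :
    eLpNorm f (ENNReal.ofReal p) (uniformMeasure Y) = ENNReal.ofReal Y⁻¹ ^ p⁻¹ *
      eLpNorm f (ENNReal.ofReal p) (volume.restrict (Set.Ioc 0 Y)) := by
  rw [uniformMeasure, eLpNorm_smul_measure_of_ne_top ENNReal.ofReal_ne_top, smul_eq_mul,
    ENNReal.toReal_div, ENNReal.toReal_one, ENNReal.toReal_ofReal hp.le, one_div]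

lemma eLpNorm_indicator_uniformMeasure_le (f : ℝ → ℝ) {s : Set ℝ} (hs : MeasurableSet s) {p : ℝ}
    (hp : 0 < p) (Y : ℝ) :
    eLpNorm (s.indicator f) (ENNReal.ofReal p) (uniformMeasure Y) ≤ ENNReal.ofReal Y⁻¹ ^ p⁻¹ *
      eLpNorm f (ENNReal.ofReal p) (volume.restrict s) := by
  rw [eLpNorm_uniformMeasure _ hp, ← eLpNorm_indicator_eq_eLpNorm_restrict hs]
  gcongr
  exact Measure.restrict_le_self

/-- A bounded interval does not contribute to the limit of the means. -/
lemma tendsto_eLpNorm_indicator_uniformMeasure {f : ℝ → ℝ} {s : Set ℝ} (hs : MeasurableSet s)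
    {p : ℝ} (hp : 0 < p) (hf : MemLp f (ENNReal.ofReal p) (volume.restrict s)) :
    Tendsto (fun Y => eLpNorm (s.indicator f) (ENNReal.ofReal p) (uniformMeasure Y)) atTop
      (𝓝 0) := by
  refine tendsto_of_tendsto_of_tendsto_of_le_of_le tendsto_const_nhds (h := fun Y =>
    ENNReal.ofReal Y⁻¹ ^ p⁻¹ * eLpNorm f (ENNReal.ofReal p) (volume.restrict s)) ?_
    (fun _ => zero_le) (fun Y => eLpNorm_indicator_uniformMeasure_le f hs hp Y)
  have h1 : Tendsto (fun Y : ℝ => ENNReal.ofReal Y⁻¹) atTop (𝓝 0) := by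
    rw [← ENNReal.ofReal_zero]
    exact ENNReal.tendsto_ofReal tendsto_inv_atTop_zero
  have h2 : Tendsto (fun Y : ℝ => ENNReal.ofReal Y⁻¹ ^ p⁻¹) atTop (𝓝 0) := by
    have := (ENNReal.continuous_rpow_const (y := p⁻¹)).continuousAt.tendsto.comp h1
    rwa [ENNReal.zero_rpow_of_pos (by positivity)] at this
  simpa using ENNReal.Tendsto.mul_const h2 (Or.inr hf.eLpNorm_ne_top)

lemma eLpNorm_indicator_Icc_uniformMeasure_le {f : ℝ → ℝ} {p y₀ Y : ℝ} (hp : 0 < p) (hY : 0 < Y)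
    (hy₀ : y₀ ≤ Y) (hf : MemLp f (ENNReal.ofReal p) (volume.restrict (Set.Icc y₀ Y))) :
    eLpNorm ((Set.Icc y₀ Y).indicator f) (ENNReal.ofReal p) (uniformMeasure Y) ≤
      ENNReal.ofReal ((Y⁻¹ * ∫ y in y₀..Y, |f y| ^ p) ^ p⁻¹) := by
  refine (eLpNorm_indicator_uniformMeasure_le f measurableSet_Icc hp Y).trans (le_of_eq ?_)
  rw [hf.eLpNorm_eq_integral_rpow_norm (by simpa using hp) ENNReal.ofReal_ne_top,
    ENNReal.toReal_ofReal hp.le, ENNReal.ofReal_rpow_of_nonneg (by positivity) (by positivity),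
    ← ENNReal.ofReal_mul (by positivity), intervalIntegral.integral_of_le hy₀,
    ← integral_Icc_eq_integral_Ioc, ← Real.mul_rpow (by positivity)
      (integral_nonneg fun y => by positivity)]
  rfl

lemma IsPFunctionWith.isMeanApproximable {φ : ℝ → ℝ} {p β : ℝ} {lam : ℕ → ℝ} {r : ℕ → ℂ}
    (hφ : IsPFunctionWith φ p lam r) (hp : 2 ≤ p) (hβ : 0 ≤ β) (hpβ : (1 - β) * p < 1 / 2)
    (hO : (fun T : ℝ => coeffMass lam r T) =O[atTop] (fun T : ℝ => 1 / T ^ β)) :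
    IsMeanApproximable φ p lam r := by
  have hp0 : 0 < p := by linarith
  have hone : (1 : ENNReal) ≤ ENNReal.ofReal p := by
    rw [ENNReal.one_le_ofReal]; linarith
  have hlim := hφ.tendsto_atTop
  obtain ⟨y₀, X₀, hy₀, hX₀, hφ₀, E, hE, X, hXmono, hXX₀, hEmem, hElim⟩ := hφ.expansion
  let S : ℝ → Finset ℕ := fun Y => (finite_setOf_apply_le hlim (X Y)).toFinset
  have hexp : ∀ᶠ Y in atTop, ∀ y, y₀ ≤ y → φ y = (expSum lam r (S Y) y).re + E y (X Y) := by
    filter_upwards [hXX₀] with Y hY y hy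
    rw [hE y (X Y) hy hY, trigSum_eq_expSum r hφ.pos hlim]
  constructor
  · -- Large intervals contain all others.
    have hmem : ∀ᶠ Y in atTop, MemLp φ (ENNReal.ofReal p) (volume.restrict (Set.Ioc 0 Y)) := by
      filter_upwards [hexp, hEmem] with Y hY hEY
      have hc : MemLp (fun y => (expSum lam r (S Y) y).re) (ENNReal.ofReal p)
          (volume.restrict (Set.Icc y₀ Y)) := by
        obtain ⟨B, hB⟩ : ∃ B, ∀ y, |(expSum lam r (S Y) y).re| ≤ B :=
          ⟨_, abs_re_expSum_le lam r (S Y)⟩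
        exact MemLp.of_bound (continuous_re_expSum lam r (S Y)).aestronglyMeasurable B
          (Eventually.of_forall hB)
      have h1 := (memLp_indicator_iff_restrict measurableSet_Icc).2 hφ₀
      have h2 := (memLp_indicator_iff_restrict measurableSet_Icc).2 (hc.add hEY)
      have h3 := h2.indicator (measurableSet_Ioi (a := y₀))
      refine MemLp.ae_eq ?_ ((h1.add h3).restrict (Set.Ioc 0 Y))
      refine (ae_restrict_iff' measurableSet_Ioc).2 (Eventually.of_forall fun y hy => ?_)
      rcases le_or_gt y y₀ with h | h
      · simp [Set.indicator, h, hy.1.le, not_lt.2 h]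
      · simp [Set.indicator, h, not_le.2 h, h.le, hy.2, hY y h.le]
    intro Y
    obtain ⟨Z, hZ, hYZ⟩ := (hmem.and (eventually_ge_atTop Y)).exists
    exact hZ.mono_measure (Measure.restrict_mono (Set.Ioc_subset_Ioc_right hYZ) le_rfl)
  · intro ε hε
    obtain ⟨T₀, C, hC, hmass⟩ := exists_sum_norm_filter_le hlim hO
    obtain ⟨N, hN⟩ := exists_forall_eLpNorm_expSum_le hp hβ hpβ hC hmass
      (by linarith : 0 < ε / 3)
    -- The frequencies below `N` that occur in the sums of length `X Y`. If `X` is bounded, these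
    -- need not be all the frequencies below `N`.
    classical
    let F : Finset ℕ :=
      (finite_setOf_apply_le hlim N).toFinset.filter fun n => ∃ Y, y₀ ≤ Y ∧ lam n ≤ X Y
    refine ⟨F, ?_⟩
    have hFS : ∀ᶠ Y in atTop, F ⊆ S Y := by
      have h1 : ∀ n ∈ F, ∀ᶠ Y in atTop, n ∈ S Y := by
        intro n hn
        obtain ⟨Z, hZ, hnZ⟩ := (Finset.mem_filter.1 hn).2
        filter_upwards [eventually_ge_atTop Z] with Y hY
        simp only [S, Set.Finite.mem_toFinset, Set.mem_ofPred_eq]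
        exact hnZ.trans (hXmono hZ (hZ.trans hY) hY)
      filter_upwards [(Finset.eventually_all F).2 h1] with Y hY n hn using hY n hn
    have hterm1 : ∀ᶠ Y in atTop, eLpNorm ((Set.Icc 0 y₀).indicator
        fun y => φ y - (expSum lam r F y).re) (ENNReal.ofReal p) (uniformMeasure Y) ≤
        ENNReal.ofReal (ε / 3) := by
      have hP : MemLp (fun y => (expSum lam r F y).re) (ENNReal.ofReal p)
          (volume.restrict (Set.Icc 0 y₀)) :=
        MemLp.of_bound (continuous_re_expSum lam r F).aestronglyMeasurable _
          (Eventually.of_forall (abs_re_expSum_le lam r F))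
      exact (tendsto_eLpNorm_indicator_uniformMeasure measurableSet_Icc hp0
        (hφ₀.sub hP)).eventually_le_const (by simp [hε])
    have hterm2 : ∀ᶠ Y in atTop, (Y⁻¹ * ∫ y in y₀..Y, |E y (X Y)| ^ p) ^ p⁻¹ ≤ ε / 3 := by
      have h1 := hElim.rpow_const (p := p⁻¹) (Or.inr (by positivity))
      rw [Real.zero_rpow (by positivity)] at h1
      exact h1.eventually_le_const (by linarith)
    filter_upwards [hexp, hEmem, hFS, hterm1, hterm2, eventually_ge_atTop 1,
      eventually_ge_atTop y₀] with Y hY hEY hFSY h1 h2 hY1 hYy₀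
    have hY0 : 0 < Y := by linarith
    have hsplit : ∀ y, (expSum lam r (S Y) y).re =
        (expSum lam r F y).re + (expSum lam r (S Y \ F) y).re := by
      intro y
      rw [← Complex.add_re, expSum, expSum, expSum, add_comm, Finset.sum_sdiff hFSY]
    have htail : ∀ n ∈ S Y \ F, N ≤ lam n := by
      intro n hn
      by_contra hlt
      obtain ⟨hnS, hnF⟩ := Finset.mem_sdiff.1 hn
      refine hnF (Finset.mem_filter.2 ⟨?_, Y, hYy₀, ?_⟩)
      · simpa using (not_le.1 hlt).le
      · simpa [S] using hnS
    -- On `(0, Y]` the difference is the sum of its restriction to `[0, y₀]`, the remainder `E`, and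
    -- an exponential sum over frequencies at least `N`.
    set f₁ := (Set.Icc 0 y₀).indicator fun y => φ y - (expSum lam r F y).re
    set f₂ := (Set.Ioi y₀).indicator ((Set.Icc y₀ Y).indicator fun y => E y (X Y))
    set f₃ := (Set.Ioi y₀).indicator fun y => (expSum lam r (S Y \ F) y).re
    have hsum : (fun y => φ y - (expSum lam r F y).re) =ᵐ[uniformMeasure Y] f₁ + (f₂ + f₃) := by
      refine Measure.ae_smul_measure ?_ _
      refine (ae_restrict_iff' measurableSet_Ioc).2 (Eventually.of_forall fun y hy => ?_)
      rcases le_or_gt y y₀ with h | h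
      · simp [f₁, f₂, f₃, Set.indicator, h, hy.1.le, not_lt.2 h]
      · have h3 := hY y h.le
        have h4 := hsplit y
        simp only [f₁, f₂, f₃, Set.indicator, Pi.add_apply, Set.mem_Icc, Set.mem_Ioi, h,
          not_le.2 h, h.le, hy.2, and_self, and_false, if_true, if_false]
        linarith
    have hm₁ : AEStronglyMeasurable f₁ (uniformMeasure Y) := by
      refine AEStronglyMeasurable.smul_measure (AEStronglyMeasurable.restrict ?_) _
      exact (aestronglyMeasurable_indicator_iff measurableSet_Icc).2
        (hφ₀.aestronglyMeasurable.sub (continuous_re_expSum lam r F).aestronglyMeasurable)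
    have hm₂ : AEStronglyMeasurable f₂ (uniformMeasure Y) := by
      refine AEStronglyMeasurable.smul_measure (AEStronglyMeasurable.restrict ?_) _
      exact ((aestronglyMeasurable_indicator_iff measurableSet_Icc).2
        hEY.aestronglyMeasurable).indicator measurableSet_Ioi
    have hm₃ : AEStronglyMeasurable f₃ (uniformMeasure Y) :=
      (continuous_re_expSum lam r _).aestronglyMeasurable.indicator measurableSet_Ioi
    have hb₂ : eLpNorm f₂ (ENNReal.ofReal p) (uniformMeasure Y) ≤ ENNReal.ofReal (ε / 3) :=
      (eLpNorm_indicator_le _).trans ((eLpNorm_indicator_Icc_uniformMeasure_le hp0 hY0 hYy₀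
        hEY).trans (ENNReal.ofReal_le_ofReal h2))
    have hb₃ : eLpNorm f₃ (ENNReal.ofReal p) (uniformMeasure Y) ≤ ENNReal.ofReal (ε / 3) :=
      (eLpNorm_indicator_le _).trans ((eLpNorm_mono fun y => Complex.abs_re_le_norm _).trans
        (hN _ htail Y hY1))
    rw [eLpNorm_congr_ae hsum]
    calc _ ≤ ENNReal.ofReal (ε / 3) + (ENNReal.ofReal (ε / 3) + ENNReal.ofReal (ε / 3)) :=
          (eLpNorm_add_le hm₁ (hm₂.add hm₃) hone).trans
            (add_le_add h1 ((eLpNorm_add_le hm₂ hm₃ hone).trans (add_le_add hb₂ hb₃)))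
      _ = ENNReal.ofReal ε := by
          rw [← ENNReal.ofReal_add (by positivity) (by positivity),
            ← ENNReal.ofReal_add (by positivity) (by positivity)]
          congr 1
          ring

/-! ### Existence and uniqueness of the limiting distribution -/

lemma IsLimitingDistribution.unique {φ : ℝ → ℝ} {μ ν : Measure ℝ}
    (hμ : IsLimitingDistribution φ μ) (hν : IsLimitingDistribution φ ν) : ν = μ := by
  have := hμ.isProbabilityMeasure
  have := hν.isProbabilityMeasure
  exact ext_of_forall_integral_eq_of_IsFiniteMeasure fun g =>
    tendsto_nhds_unique (hν.tendsto g) (hμ.tendsto g)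

namespace IsMeanApproximable

variable {φ : ℝ → ℝ} {p : ℝ} {lam : ℕ → ℝ} {r : ℕ → ℂ}

lemma isLimitingDistribution (h : IsMeanApproximable φ p lam r) {μ : ProbabilityMeasure ℝ}
    (hμ : Tendsto h.law atTop (𝓝 μ)) : IsLimitingDistribution φ μ where
  isProbabilityMeasure := inferInstance
  aemeasurable := by
    have hU : Set.Ici (0 : ℝ) = ⋃ k : ℕ, Set.Icc (0 : ℝ) k := by
      ext y
      simp only [Set.mem_Ici, Set.mem_iUnion, Set.mem_Icc]
      exact ⟨fun hy => (exists_nat_ge y).imp fun k hk => ⟨hy, hk⟩, fun ⟨k, hk⟩ => hk.1⟩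
    rw [hU, aemeasurable_iUnion_iff]
    intro k
    rw [← restrict_Ioc_eq_restrict_Icc]
    exact (h.memLp k).aestronglyMeasurable.aemeasurable
  tendsto g := by
    refine (h.tendsto_integral_of_tendsto_law hμ g).congr' ?_
    filter_upwards [eventually_gt_atTop 0] with Y hY
    rw [integral_uniformMeasure hY, smul_eq_mul]

lemma intervalIntegrable_pow (h : IsMeanApproximable φ p lam r) {n : ℕ} (hn : (n : ℝ) ≤ p)
    {Y : ℝ} (hY : 0 ≤ Y) : IntervalIntegrable (fun y => φ y ^ n) volume 0 Y := by
  rw [intervalIntegrable_iff_integrableOn_Ioc_of_le hY]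
  have hexp : (n : ENNReal) ≤ ENNReal.ofReal p := by
    rw [← ENNReal.ofReal_natCast]
    exact ENNReal.ofReal_le_ofReal hn
  have h1 := (h.memLp Y).mono_exponent hexp
  rcases Nat.eq_zero_or_pos n with rfl | hn0
  · simp
  · refine (integrable_norm_iff (h1.aestronglyMeasurable.pow n)).1 ?_
    simpa only [Pi.pow_apply, norm_pow] using h1.integrable_norm_pow hn0.ne'

end IsMeanApproximable

theorem corollary1p4 (φ : ℝ → ℝ) (p β : ℝ) (hp : 2 ≤ p) (hβ : 1 - 1 / (2 * p + 4) < β)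
    (hφ : IsPBetaFunction φ p β) :
    ∃ μ : Measure ℝ, IsLimitingDistribution φ μ ∧
      (∀ ν : Measure ℝ, IsLimitingDistribution φ ν → ν = μ) ∧
      ∀ n : ℕ, 1 ≤ n → (n : ℝ) ≤ p →
        (∀ Y : ℝ, 0 ≤ Y → IntervalIntegrable (fun y => φ y ^ n) volume 0 Y) ∧
        Integrable (fun x : ℝ => x ^ n) μ ∧
        Tendsto (fun Y : ℝ => Y⁻¹ * ∫ y in (0 : ℝ)..Y, φ y ^ n) atTop (𝓝 (∫ x, x ^ n ∂μ)) := by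
  obtain ⟨lam, r, hlam, hO⟩ := hφ
  have hp1 : 1 ≤ p := by linarith
  have hdiv : p / (2 * p + 4) < 1 / 2 := by
    rw [div_lt_div_iff₀ (by linarith) (by norm_num)]
    linarith
  have hβ0 : 0 ≤ β := by
    have : 1 / (2 * p + 4) ≤ 1 := by
      rw [div_le_one (by linarith)]
      linarith
    linarith
  have hpβ : (1 - β) * p < 1 / 2 := by
    refine lt_of_le_of_lt ?_ hdiv
    calc (1 - β) * p ≤ 1 / (2 * p + 4) * p := by
          gcongr
          linarith
      _ = _ := by ring
  have h := hlam.isMeanApproximable hp hβ0 hpβ hO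
  obtain ⟨μ, hμ⟩ := h.exists_tendsto_law hp1
  have hdist := h.isLimitingDistribution hμ
  refine ⟨μ, hdist, fun ν hν => hdist.unique hν, fun n _ hn => ?_⟩
  obtain ⟨hint, hlim⟩ := h.integrable_pow_and_tendsto_integral_pow hp1 hμ hn
  refine ⟨fun Y hY => h.intervalIntegrable_pow hn hY, hint, hlim.congr' ?_⟩
  filter_upwards [eventually_gt_atTop 0] with Y hY
  rw [integral_uniformMeasure hY, smul_eq_mul]
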